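/- Let $k$ be an algebraically closed field and let $Q_1$ be the quiver with three vertices $b,\mathrm{mid},e$ and three arrows $b\to e$, $b\to \mathrm{mid}$, $\mathrm{mid}\to e$. Let $Rep_k(Q_1)$ be the category of finite-dimensional $k$-representations of $Q_1$. A representation is written $(V_b,V_{\mathrm{mid}},V_e;f,g,h)$ with $f:V_b\to V_e$, $g:V_b\to V_{\mathrm{mid}}$, $h:V_{\mathrm{mid}}\to V_e$. For $m\ge 0$ let $\pi_+^m,\pi_-^m:k^{m+1}\to k^m$ and $j_+^m,j_-^m:k^m\to k^{m+1}$ be $$\pi_+^m(a_1,\dots,a_{m+1})=(a_1,\dots,a_m),\quad \pi_-^m(a_1,\dots,a_{m+1})=(a_2,\dots,a_{m+1}),$$ $$j_+^m(a_1,\dots,a_m)=(a_1,\dots,a_m,0),\quad j_-^m(a_1,\dots,a_m)=(0,a_1,\dots,a_m),$$ and put $$E_1^m=(k^{m+1},k^m,k^m;\pi_+^m,\pi_-^m,\mathrm{Id}),\qquad E_2^m=(k^m,k^{m+1},k^{m+1};j_+^m,j_-^m,\mathrm{Id}),$$ $$E_3^m=(k^m,k^m,k^{m+1};j_+^m,\mathrm{Id},j_-^m),\qquad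 E_4^m=(k^{m+1},k^{m+1},k^m;\pi_+^m,\mathrm{Id},\pi_-^m),$$ $$M=(0,k,0;0,0,0),\qquad M'=(k,0,k;\mathrm{Id},0,0).$$ An object $X$ of $Rep_k(Q_1)$ is exceptional if $\mathrm{Hom}(X,X)=k$ and $\mathrm{Ext}^n(X,X)=0$ for all $n\neq 0$. A finite sequence $(X_0,\dots,X_n)$ of exceptional objects of $Rep_k(Q_1)$ is an exceptional collection if $\mathrm{Ext}^p(X_j,X_i)=0$ for all $i<j$ and all $p\ge 0$. An exceptional triple is an exceptional collection with three members. An exceptional collection is full if the smallest strictly full triangulated subcategory of $D^b(Rep_k(Q_1))$ containing its members is $D^b(Rep_k(Q_1))$. Two collections are isomorphic if they have the same length and their respective members are isomorphic. Then a finite sequence of objects of $Rep_k(Q_1)$ is a full exceptional collection if and only if it is isomorphic to one of the following triples ($m\in\mathbb N=\{0,1,2,\dots\}$), and a triple of objects of $Rep_k(Q_1)$ is an exceptional triple if and only if it is isomorphic to one of them: $$\begin{array}{ccc} (E_1^{m+1},E_1^m,M) & (E_1^{m+1},E_4^m,E_1^m) & (E_1^{m+1},M,E_4^m)\\ (E_1^0,E_2^0,M)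 & (E_1^0,E_3^0,E_2^0) & (E_1^0,M,E_3^0)\\ (E_2^m,E_2^{m+1},M) & (E_2^m,E_3^{m+1},E_2^{m+1}) & (E_2^m,M,E_3^{m+1})\\ (E_3^m,E_2^m,E_3^{m+1}) & (E_3^m,E_3^{m+1},M') & (E_3^m,M',E_2^m)\\ (E_4^{m+1},E_4^m,M') & (E_4^{m+1},E_1^{m+1},E_4^m) & (E_4^{m+1},M',E_1^{m+1})\\ (E_4^0,E_1^0,E_3^0) & (E_4^0,E_3^0,M') & (E_4^0,M',E_1^0)\\ (M,E_3^m,E_3^{m+1}) & (M,E_4^{m+1},E_4^m) & (M,E_4^0,E_3^0)\\ (M',E_1^{m+1},E_1^m) & (M',E_2^m,E_2^{m+1}) & (M',E_1^0,E_2^0) \end{array}$$ Moreover, no two triples of this list (different entries of the table, or the same entry with different values of $m$) are isomorphic. -/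

import Mathlib

open CategoryTheory

universe v u

noncomputable section

namespace ExcColl

/-! ### Exceptional collections in a `k`-linear abelian category -/

section General

universe w

variable (k : Type w) [Field k] {C : Type u} [Category.{v} C] [Abelian C]

/- The `Ext`-groups and the derived category exist without any smallness assumption in the
universe `max u v`. -/
attribute [local instance] HasExt.standard HasDerivedCategory.standard

/-- `Hom^n(X, Y) = Ext^n(X, Y) = 0` for all `n ≥ 0`. (In negative degrees this always holds for
objects of an abelian category.) -/
def HomVanish (X Y : C) : Prop :=
  ∀ n : ℕ, Subsingleton (Abelian.Ext.{max u v} X Y n)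

/-- `X` is exceptional: `Hom(X, X) = k` (the scalars are all the endomorphisms, and `X ≠ 0`) and
`Ext^n(X, X) = 0` for all `n ≠ 0`. -/
def IsExceptional [Linear k C] (X : C) : Prop :=
  Function.Bijective (fun c : k => c • 𝟙 X) ∧
    ∀ n : ℕ, n ≠ 0 → Subsingleton (Abelian.Ext.{max u v} X X n)

/-- `[E₀, …, Eₙ]` is an exceptional collection: each `Eᵢ` is exceptional and
`Hom^*(Eⱼ, Eᵢ) = 0` for `i < j`. -/
def IsExceptionalCollection [Linear k C] (E : List C) : Prop :=
  (∀ X ∈ E, IsExceptional k X) ∧ E.Pairwise (fun X Y => HomVanish Y X)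

/-- An object of `C`, seen in the bounded derived category as a complex in degree `0`. -/
def toDb (X : C) : DerivedCategory.Bounded C :=
  ⟨(DerivedCategory.singleFunctor C 0).obj X,
    ⟨⟨0, inferInstance⟩, ⟨0, inferInstance⟩⟩⟩

/-- The objects of the list `E` generate `D^b(C)`: the only strictly full triangulated
subcategory of `D^b(C)` that contains all of them is `D^b(C)` itself. -/
def GeneratesDb (E : List C) : Prop :=
  ∀ P : ObjectProperty (DerivedCategory.Bounded C),
    P.IsTriangulated → P.IsClosedUnderIsomorphisms →
      (∀ X ∈ E, P (toDb X)) → ∀ Y : DerivedCategory.Bounded C, P Y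

/-- A full exceptional collection. -/
def IsFullExceptionalCollection [Linear k C] (E : List C) : Prop :=
  IsExceptionalCollection k E ∧ GeneratesDb E

/-- Two collections are isomorphic: they have the same length and isomorphic members. -/
def IsoColl (E F : List C) : Prop :=
  List.Forall₂ (fun X Y => Nonempty (X ≅ Y)) E F

end General

/-! ### Representations of quivers, and the quiver `Q₁` -/

/-- The category of finite-dimensional representations over `k` of a quiver `Q`. -/
abbrev Rep (k : Type u) [Field k] (Q : Type) [Quiver.{0} Q] : Type (u + 1) :=
  Paths Q ⥤ FGModuleCat.{u} k

/-- The vertices of `Q₁`. -/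
inductive Q1 : Type
  | b
  | mid
  | e

/-- The arrows of `Q₁`: `b ⟶ e`, `b ⟶ mid` and `mid ⟶ e`. -/
inductive Q1.Arrow : Q1 → Q1 → Type
  | be : Q1.Arrow Q1.b Q1.e
  | bm : Q1.Arrow Q1.b Q1.mid
  | me : Q1.Arrow Q1.mid Q1.e

instance : Quiver.{0} Q1 where
  Hom := Q1.Arrow

section Objects

variable (k : Type u) [Field k]

/-- The vector space `k^n`. -/
abbrev vec (n : ℕ) : FGModuleCat.{u} k := FGModuleCat.of k (Fin n → k)

/-- The spaces of the representation with dimension vector `(nb, nm, ne)`. -/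
def vertexSpace (nb nm ne : ℕ) : Q1 → FGModuleCat.{u} k
  | Q1.b => vec k nb
  | Q1.mid => vec k nm
  | Q1.e => vec k ne

/-- The representation of `Q₁` with the spaces `k^nb`, `k^nm`, `k^ne` at `b`, `mid`, `e`
and the maps `f`, `g`, `h` along `b ⟶ e`, `b ⟶ mid`, `mid ⟶ e`. -/
def mkRep {nb nm ne : ℕ} (f : (Fin nb → k) →ₗ[k] (Fin ne → k))
    (g : (Fin nb → k) →ₗ[k] (Fin nm → k)) (h : (Fin nm → k) →ₗ[k] (Fin ne → k)) :
    Rep k Q1 :=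
  Paths.lift
    { obj := vertexSpace k nb nm ne
      map := fun {_ _} a =>
        match a with
        | Q1.Arrow.be => FGModuleCat.ofHom f
        | Q1.Arrow.bm => FGModuleCat.ofHom g
        | Q1.Arrow.me => FGModuleCat.ofHom h }

/-- `(a₁, …, aₘ, aₘ₊₁) ↦ (a₁, …, aₘ)` -/
def piPlus (m : ℕ) : (Fin (m + 1) → k) →ₗ[k] (Fin m → k) where
  toFun a := fun i => a i.castSucc
  map_add' _ _ := rfl
  map_smul' _ _ := rfl

/-- `(a₁, …, aₘ, aₘ₊₁) ↦ (a₂, …, aₘ₊₁)` -/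
def piMinus (m : ℕ) : (Fin (m + 1) → k) →ₗ[k] (Fin m → k) where
  toFun a := fun i => a i.succ
  map_add' _ _ := rfl
  map_smul' _ _ := rfl

/-- `(a₁, …, aₘ) ↦ (a₁, …, aₘ, 0)` -/
def jPlus (m : ℕ) : (Fin m → k) →ₗ[k] (Fin (m + 1) → k) where
  toFun a := Fin.snoc (α := fun _ => k) a 0
  map_add' x y := by
    ext i
    refine Fin.lastCases ?_ (fun j => ?_) i <;> simp
  map_smul' c x := by
    ext i
    refine Fin.lastCases ?_ (fun j => ?_) i <;> simp

/-- `(a₁, …, aₘ) ↦ (0, a₁, …, aₘ)` -/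
def jMinus (m : ℕ) : (Fin m → k) →ₗ[k] (Fin (m + 1) → k) where
  toFun a := Fin.cons (α := fun _ => k) 0 a
  map_add' x y := by
    ext i
    refine Fin.cases ?_ (fun j => ?_) i <;> simp
  map_smul' c x := by
    ext i
    refine Fin.cases ?_ (fun j => ?_) i <;> simp

/-- Dimension vector `(m+1, m, m)`. -/
def E₁ (m : ℕ) : Rep k Q1 := mkRep k (piPlus k m) (piMinus k m) LinearMap.id

/-- Dimension vector `(m, m+1, m+1)`. -/
def E₂ (m : ℕ) : Rep k Q1 := mkRep k (jPlus k m) (jMinus k m) LinearMap.id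

/-- Dimension vector `(m, m, m+1)`. -/
def E₃ (m : ℕ) : Rep k Q1 := mkRep k (jPlus k m) LinearMap.id (jMinus k m)

/-- Dimension vector `(m+1, m+1, m)`. -/
def E₄ (m : ℕ) : Rep k Q1 := mkRep k (piPlus k m) LinearMap.id (piMinus k m)

/-- Dimension vector `(0, 1, 0)`. -/
def M : Rep k Q1 := mkRep k (nb := 0) (nm := 1) (ne := 0) 0 0 0

/-- Dimension vector `(1, 0, 1)`, with the identity along `b ⟶ e`. -/
def M' : Rep k Q1 := mkRep k (nb := 1) (nm := 0) (ne := 1) LinearMap.id 0 0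

end Objects

/-! ### The list of triples -/

/-- The labels of the listed triples: 24 families, of which 16 depend on `m` and 8 consist of
a single triple. The label `tIJ` belongs to row `I`, column `J` of an 8 × 3 table. -/
inductive Label : Type
  | t11 (m : ℕ) | t12 (m : ℕ) | t13 (m : ℕ)
  | t21 | t22 | t23
  | t31 (m : ℕ) | t32 (m : ℕ) | t33 (m : ℕ)
  | t41 (m : ℕ) | t42 (m : ℕ) | t43 (m : ℕ)
  | t51 (m : ℕ) | t52 (m : ℕ) | t53 (m : ℕ)
  | t61 | t62 | t63
  | t71 (m : ℕ) | t72 (m : ℕ) | t73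
  | t81 (m : ℕ) | t82 (m : ℕ) | t83

/-- The triple with a given label. -/
def triple (k : Type u) [Field k] : Label → List (Rep k Q1)
  | .t11 m => [E₁ k (m + 1), E₁ k m, M k]
  | .t12 m => [E₁ k (m + 1), E₄ k m, E₁ k m]
  | .t13 m => [E₁ k (m + 1), M k, E₄ k m]
  | .t21 => [E₁ k 0, E₂ k 0, M k]
  | .t22 => [E₁ k 0, E₃ k 0, E₂ k 0]
  | .t23 => [E₁ k 0, M k, E₃ k 0]
  | .t31 m => [E₂ k m, E₂ k (m + 1), M k]
  | .t32 m => [E₂ k m, E₃ k (m + 1), E₂ k (m + 1)]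
  | .t33 m => [E₂ k m, M k, E₃ k (m + 1)]
  | .t41 m => [E₃ k m, E₂ k m, E₃ k (m + 1)]
  | .t42 m => [E₃ k m, E₃ k (m + 1), M' k]
  | .t43 m => [E₃ k m, M' k, E₂ k m]
  | .t51 m => [E₄ k (m + 1), E₄ k m, M' k]
  | .t52 m => [E₄ k (m + 1), E₁ k (m + 1), E₄ k m]
  | .t53 m => [E₄ k (m + 1), M' k, E₁ k (m + 1)]
  | .t61 => [E₄ k 0, E₁ k 0, E₃ k 0]
  | .t62 => [E₄ k 0, E₃ k 0, M' k]
  | .t63 => [E₄ k 0, M' k, E₁ k 0]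
  | .t71 m => [M k, E₃ k m, E₃ k (m + 1)]
  | .t72 m => [M k, E₄ k (m + 1), E₄ k m]
  | .t73 => [M k, E₄ k 0, E₃ k 0]
  | .t81 m => [M' k, E₁ k (m + 1), E₁ k m]
  | .t82 m => [M' k, E₂ k m, E₂ k (m + 1)]
  | .t83 => [M' k, E₁ k 0, E₂ k 0]

end ExcColl

end

/-! The category is hereditary: the simple modules have projective resolutions of length at most
one, so only `Hom` and `Ext¹` matter. They are the kernel and cokernel of one linear map `diff`,
whence dim Hom − dim Ext¹ is the Euler form of the dimension vectors (`finrank_hom_eq`,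
`subsingleton_ext_one_iff`).

An exceptional object therefore has a dimension vector of Euler norm 1. With p = a − b and q = b − c
the norm is p² + pq + q², so there are six families of candidates (`exists_dim_eq`). Four are the
dimension vectors of the `E₁`, …, `E₄`. The other two are (m, m+1, m) and (m+1, m, m+1), and they
carry exceptional objects only for m = 0, namely `M` and `M'`. An exceptional object is determined
by its dimension vector (`nonempty_iso_of_dimv_eq`), so this classifies them (`exists_iso_rep`).

Between two objects of the list, a vanishing Euler form already forces `Hom` to vanish, by a
computation with Toeplitz matrices (`hom_rep_eq_zero`). Hence all `Ext` groups vanish exactly when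
an integer does (`homVanish_iff_of_iso`), and finding the exceptional triples becomes a finite case
analysis on labels (`exists_label_of_eulZero`).

Each listed triple generates: five kinds of short exact sequences lead from it to `M` and `M'`, and
then down to the three simples (`simples_of_code`). A collection with at most two members has a
nonzero right orthogonal, so it does not generate. A collection with four or more members cannot
exist: its first member would be right orthogonal to a triple that generates. -/

noncomputable section

namespace ExcColl

/-! ### Representations vertex by vertex: morphisms, monos, epis, short exact sequences. -/

section Reps
open Limits
variable {k : Type u} [Field k] {Q : Type} [Quiver.{0} Q]

/-- The action of an arrow on a representation, as a linear map. -/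
def act (X : Rep k Q) {i j : Q} (a : i ⟶ j) : X.obj i →ₗ[k] X.obj j :=
  (X.map (Quiver.Hom.toPath a)).hom.hom

/-- The component of a morphism of representations at a vertex, as a linear map. -/
def comp {X Y : Rep k Q} (φ : X ⟶ Y) (v : Q) : X.obj v →ₗ[k] Y.obj v :=
  (φ.app v).hom.hom

lemma comp_act {X Y : Rep k Q} (φ : X ⟶ Y) {i j : Q} (a : i ⟶ j) :
    comp φ j ∘ₗ act X a = act Y a ∘ₗ comp φ i :=
  congrArg (fun f => f.hom.hom) (φ.naturality (Quiver.Hom.toPath a))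

lemma comp_act_apply {X Y : Rep k Q} (φ : X ⟶ Y) {i j : Q} (a : i ⟶ j) (x : X.obj i) :
    comp φ j (act X a x) = act Y a (comp φ i x) :=
  LinearMap.congr_fun (comp_act φ a) x

@[simp] lemma comp_comp {X Y Z : Rep k Q} (φ : X ⟶ Y) (ψ : Y ⟶ Z) (v : Q) :
    comp (φ ≫ ψ) v = comp ψ v ∘ₗ comp φ v := rfl

lemma hom_ext {X Y : Rep k Q} {φ ψ : X ⟶ Y} (h : ∀ v, comp φ v = comp ψ v) : φ = ψ := by
  apply NatTrans.ext
  funext v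
  exact FGModuleCat.hom_ext (h v)

/-- A morphism of representations from its components. -/
def homMk {X Y : Rep k Q} (u : ∀ v : Q, X.obj v →ₗ[k] Y.obj v)
    (h : ∀ {i j : Q} (a : i ⟶ j), u j ∘ₗ act X a = act Y a ∘ₗ u i) : X ⟶ Y where
  app v := FGModuleCat.ofHom (u v)
  naturality := by
    intro i j p
    induction p using Paths.induction_fixed_source with
    | id => simp
    | comp p a ih =>
      rw [X.map_comp, Y.map_comp, Category.assoc, ← reassoc_of% ih]
      congr 1
      exact FGModuleCat.hom_ext (h a)

@[simp] lemma comp_homMk {X Y : Rep k Q} (u : ∀ v : Q, X.obj v →ₗ[k] Y.obj v)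
    (h : ∀ {i j : Q} (a : i ⟶ j), u j ∘ₗ act X a = act Y a ∘ₗ u i) (v : Q) :
    comp (homMk u h) v = u v := rfl

/-- A representation from vector spaces and linear maps. -/
def ofMaps (V : Q → FGModuleCat.{u} k) (r : ∀ {i j : Q} (_ : i ⟶ j), V i →ₗ[k] V j) : Rep k Q :=
  Paths.lift { obj := V, map := fun a => FGModuleCat.ofHom (r a) }

@[simp] lemma act_ofMaps (V : Q → FGModuleCat.{u} k)
    (r : ∀ {i j : Q} (_ : i ⟶ j), V i →ₗ[k] V j) {i j : Q} (a : i ⟶ j) :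
    act (ofMaps V r) a = r a := by
  unfold act ofMaps
  rw [Paths.lift_toPath]
  rfl

/-- Evaluation at a vertex, with values in modules. -/
abbrev ev (k : Type u) [Field k] (v : Paths Q) : Rep k Q ⥤ ModuleCat.{u} k :=
  (evaluation (Paths Q) (FGModuleCat k)).obj v ⋙ forget₂ (FGModuleCat k) (ModuleCat k)

lemma mono_iff {X Y : Rep k Q} (φ : X ⟶ Y) : Mono φ ↔ ∀ v, Function.Injective (comp φ v) := by
  rw [NatTrans.mono_iff_mono_app]
  refine forall_congr' fun v => ?_
  rw [← Functor.mono_map_iff_mono (forget₂ (FGModuleCat k) (ModuleCat k)), ModuleCat.mono_iff_injective]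
  rfl

lemma epi_iff {X Y : Rep k Q} (φ : X ⟶ Y) : Epi φ ↔ ∀ v, Function.Surjective (comp φ v) := by
  rw [NatTrans.epi_iff_epi_app]
  refine forall_congr' fun v => ?_
  rw [← Functor.epi_map_iff_epi (forget₂ (FGModuleCat k) (ModuleCat k)), ModuleCat.epi_iff_surjective]
  rfl

lemma isIso_iff {X Y : Rep k Q} (φ : X ⟶ Y) : IsIso φ ↔ ∀ v, Function.Bijective (comp φ v) := by
  constructor
  · intro h v
    exact ⟨(mono_iff φ).1 inferInstance v, (epi_iff φ).1 inferInstance v⟩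
  · intro h
    have := (mono_iff φ).2 fun v => (h v).1
    have := (epi_iff φ).2 fun v => (h v).2
    exact isIso_of_mono_of_epi φ

lemma isZero_iff (X : Rep k Q) : IsZero X ↔ ∀ v, Subsingleton (X.obj v) := by
  rw [IsZero.iff_id_eq_zero]
  constructor
  · intro h v
    refine ⟨fun x y => ?_⟩
    have : comp (𝟙 X) v = comp (0 : X ⟶ X) v := by rw [h]
    have hx := LinearMap.congr_fun this x
    have hy := LinearMap.congr_fun this y
    exact hx.trans hy.symm
  · intro h
    refine hom_ext fun v => LinearMap.ext fun x => ?_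
    have := h v
    exact Subsingleton.elim _ _

lemma _root_.CategoryTheory.ShortComplex.ShortExact.function_exact {S : ShortComplex (Rep k Q)}
    (hS : S.ShortExact) (v : Paths Q) :
    Function.Exact (comp S.f v) (comp S.g v) :=
  (ShortComplex.ShortExact.moduleCat_exact_iff_function_exact _).1
    (hS.map_of_exact (ev k v)).exact

lemma _root_.CategoryTheory.ShortComplex.ShortExact.finrank_add {S : ShortComplex (Rep k Q)}
    (hS : S.ShortExact) (v : Q) :
    Module.finrank k (S.X₁.obj v) + Module.finrank k (S.X₃.obj v) =
      Module.finrank k (S.X₂.obj v) := by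
  have hf := (mono_iff S.f).1 hS.mono_f v
  have hg := (epi_iff S.g).1 hS.epi_g v
  have he := LinearMap.exact_iff.1 (hS.function_exact v)
  have h1 := LinearMap.finrank_range_add_finrank_ker (comp S.g v)
  rw [he, LinearMap.finrank_range_of_inj hf, LinearMap.range_eq_top.2 hg, finrank_top] at h1
  omega

lemma shortExact_mk {X Y Z : Rep k Q} (f : X ⟶ Y) (g : Y ⟶ Z)
    (hf : ∀ v, Function.Injective (comp f v)) (hg : ∀ v, Function.Surjective (comp g v))
    (hfg : ∀ v, Function.Exact (comp f v) (comp g v)) :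
    ∃ w : f ≫ g = 0, (ShortComplex.mk f g w).ShortExact := by
  have w : f ≫ g = 0 := hom_ext fun v => LinearMap.ext fun x => (hfg v).apply_apply_eq_zero x
  refine ⟨w, ?_⟩
  have := (mono_iff f).2 hf
  have := (epi_iff g).2 hg
  refine ShortComplex.ShortExact.mk ?_
  rw [ShortComplex.exact_iff_isZero_homology, isZero_iff]
  intro (v : Paths Q)
  have h1 : ((ShortComplex.mk f g w).map (ev k v)).Exact :=
    (ShortComplex.ShortExact.moduleCat_exact_iff_function_exact _).2 (hfg v)
  rw [ShortComplex.exact_iff_isZero_homology] at h1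
  have h2 := h1.of_iso ((ShortComplex.mk f g w).mapHomologyIso (ev k v)).symm
  exact ModuleCat.subsingleton_of_isZero h2

end Reps

/-! ### `Ext¹` and coboundaries. -/

section ExtOne
open Limits Abelian
universe w
variable {k : Type u} [Field k] {Q : Type} [Quiver.{0} Q]

/-- Every family of linear maps along the arrows is a coboundary: the cokernel of
`⊕ Hom(X_v, Y_v) ⟶ ⊕ Hom(X_i, Y_j)`, which computes `Ext¹(X, Y)`, vanishes. -/
def CobSurj (X Y : Rep k Q) : Prop :=
  ∀ c : (∀ i j : Q, (i ⟶ j) → (X.obj i →ₗ[k] Y.obj j)),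
    ∃ t : (∀ v : Q, X.obj v →ₗ[k] Y.obj v),
      ∀ (i j : Q) (a : i ⟶ j), c i j a = act Y a ∘ₗ t i - t j ∘ₗ act X a

/-- The extension of `X` by `Y` given by a family of linear maps along the arrows. -/
def extension (X Y : Rep k Q) (c : ∀ i j : Q, (i ⟶ j) → (X.obj i →ₗ[k] Y.obj j)) : Rep k Q :=
  ofMaps (fun v => FGModuleCat.of k (Y.obj v × X.obj v))
    (fun {i j} a => ((act Y a).coprod (c i j a)).prod (act X a ∘ₗ LinearMap.snd k _ _))

variable (X Y : Rep k Q) (c : ∀ i j : Q, (i ⟶ j) → (X.obj i →ₗ[k] Y.obj j))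

lemma act_extension {i j : Q} (a : i ⟶ j) (p : Y.obj i × X.obj i) :
    act (extension X Y c) a p = (act Y a p.1 + c i j a p.2, act X a p.2) := by
  unfold extension
  rw [act_ofMaps]
  rfl

def extensionInl : Y ⟶ extension X Y c :=
  homMk (fun v => LinearMap.inl k (Y.obj v) (X.obj v)) fun {i j} a => by
    refine LinearMap.ext fun y => ?_
    refine Eq.trans ?_ (act_extension X Y c a (y, 0)).symm
    simp
    rfl

def extensionSnd : extension X Y c ⟶ X :=
  homMk (fun v => LinearMap.snd k (Y.obj v) (X.obj v)) fun {i j} a => by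
    refine LinearMap.ext fun (p : Y.obj i × X.obj i) => ?_
    exact congrArg Prod.snd (act_extension X Y c a p)

variable {X Y}

/-- The extension built from `c` must split, and the `Y`-component of a splitting, with its sign
changed, is the required `t`. -/
lemma cobSurj_of_subsingleton_ext [HasExt.{w} (Rep k Q)] (h : Subsingleton (Ext X Y 1)) :
    CobSurj X Y := by
  intro c
  obtain ⟨w, hS⟩ := shortExact_mk (extensionInl X Y c) (extensionSnd X Y c)
    (fun v => LinearMap.inl_injective) (fun v => LinearMap.snd_surjective)
    (fun v => Function.Exact.inl_snd)
  -- The obstruction to lifting `𝟙 X` through the projection lies in `Ext X Y 1`.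
  obtain ⟨e, he⟩ := Ext.covariant_sequence_exact₃ X hS (Ext.mk₀ (𝟙 X)) (zero_add 1)
    (Subsingleton.elim _ _)
  obtain ⟨s, rfl⟩ := (Ext.mk₀_bijective X (extension X Y c)).2 e
  have hs : s ≫ extensionSnd X Y c = 𝟙 X := by
    rw [Ext.mk₀_comp_mk₀] at he
    exact (Ext.mk₀_bijective X X).1 he
  have hs2 : ∀ (v : Q) (x : X.obj v), (comp s v x : Y.obj v × X.obj v).2 = x := fun v x => by
    have : comp (s ≫ extensionSnd X Y c) v x = comp (𝟙 X) v x := by rw [hs]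
    exact this
  refine ⟨fun v => - (LinearMap.fst k (Y.obj v) (X.obj v) ∘ₗ comp s v), fun i j a => ?_⟩
  refine LinearMap.ext fun x => ?_
  have h1 := (comp_act_apply s a x).trans (act_extension X Y c a (comp s i x))
  have h2 := congrArg Prod.fst h1
  rw [hs2] at h2
  have h3 : c i j a x = (comp s j (act X a x) : Y.obj j × X.obj j).1 -
      act Y a (comp s i x : Y.obj i × X.obj i).1 := by
    rw [eq_sub_iff_add_eq, add_comm]
    exact h2.symm
  rw [h3]
  change _ = act Y a (-(comp s i x : Y.obj i × X.obj i).1) -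
    -(comp s j (act X a x) : Y.obj j × X.obj j).1
  rw [map_neg]
  abel

/-- As the middle term is projective, a class in `Ext¹` comes from some `φ : S.X₁ ⟶ Y`, and it
vanishes once `φ` extends to `S.X₂`. Linear extensions exist at each vertex; the coboundary
condition is what makes them compatible with the arrows. -/
lemma subsingleton_ext_of_cobSurj [HasExt.{w} (Rep k Q)] {S : ShortComplex (Rep k Q)}
    (hS : S.ShortExact) (hP : Projective S.X₂) (h : CobSurj S.X₃ Y) :
    Subsingleton (Ext S.X₃ Y 1) := by
  refine subsingleton_of_forall_eq 0 fun e => ?_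
  obtain ⟨f, hf⟩ := Ext.contravariant_sequence_exact₃ hS Y e
    (Ext.eq_zero_of_hasProjectiveDimensionLT _ 1 le_rfl) (add_zero 1)
  obtain ⟨φ, rfl⟩ := (Ext.mk₀_bijective S.X₁ Y).2 f
  choose s hs using fun v => (comp S.g v).exists_rightInverse_of_surjective
    (LinearMap.range_eq_top.2 ((epi_iff S.g).1 hS.epi_g v))
  have hsv : ∀ v x, comp S.g v (s v x) = x := fun v x => LinearMap.congr_fun (hs v) x
  choose r hr using fun v => (comp S.f v).exists_leftInverse_of_injective
    (LinearMap.ker_eq_bot.2 ((mono_iff S.f).1 hS.mono_f v))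
  have hrv : ∀ v x, r v (comp S.f v x) = x := fun v x => LinearMap.congr_fun (hr v) x
  have hfr : ∀ v p, comp S.g v p = 0 → comp S.f v (r v p) = p := fun v p hp => by
    obtain ⟨x, rfl⟩ := (hS.function_exact v p).1 hp
    rw [hrv]
  -- The family measures how far the sections `s` are from a morphism. The bracket takes values in
  -- the kernel of `S.g`, so `r` sends it to its preimage in `S.X₁`.
  obtain ⟨t, ht⟩ := h fun i j a =>
    comp φ j ∘ₗ r j ∘ₗ (act S.X₂ a ∘ₗ s i - s j ∘ₗ act S.X₃ a)
  have hφ : ∀ (i j : Q) (a : i ⟶ j) (p : S.X₂.obj i),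
      comp φ j (r j (act S.X₂ a p - s j (comp S.g j (act S.X₂ a p)))) =
        act Y a (comp φ i (r i (p - s i (comp S.g i p)))) + act Y a (t i (comp S.g i p)) -
          t j (comp S.g j (act S.X₂ a p)) := by
    intro i j a p
    have h1 := LinearMap.congr_fun (ht i j a) (comp S.g i p)
    simp only [LinearMap.comp_apply, LinearMap.sub_apply] at h1
    have key : r j (act S.X₂ a p - s j (comp S.g j (act S.X₂ a p))) =
        act S.X₁ a (r i (p - s i (comp S.g i p))) +
          r j (act S.X₂ a (s i (comp S.g i p)) - s j (comp S.g j (act S.X₂ a p))) := by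
      apply (mono_iff S.f).1 hS.mono_f j
      rw [comp_act_apply S.g, map_add, comp_act_apply S.f, hfr j, hfr j, hfr i, map_sub]
      · abel
      · rw [map_sub, hsv, sub_self]
      · rw [map_sub, comp_act_apply, hsv, hsv, sub_self]
      · rw [map_sub, comp_act_apply, hsv, sub_self]
    rw [add_sub_assoc, comp_act_apply S.g, ← h1, ← comp_act_apply φ, ← comp_act_apply S.g]
    exact (congrArg (comp φ j) key).trans (map_add _ _ _)
  -- The first summand is `φ` along the vertexwise splitting; the correction `t ∘ S.g` does not
  -- change it on the image of `S.f`.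
  let ψ : S.X₂ ⟶ Y := homMk
    (fun v => comp φ v ∘ₗ r v ∘ₗ (LinearMap.id - s v ∘ₗ comp S.g v) + t v ∘ₗ comp S.g v)
    (fun {i j} a => by
      refine LinearMap.ext fun p => ?_
      have := hφ i j a p
      simp only [LinearMap.comp_apply, LinearMap.add_apply, LinearMap.sub_apply, LinearMap.id_apply,
        map_add] at this ⊢
      rw [this]
      abel)
  have hψ : S.f ≫ ψ = φ := by
    refine hom_ext fun v => LinearMap.ext fun x => ?_
    have h0 : comp S.g v (comp S.f v x) = 0 := (hS.function_exact v).apply_apply_eq_zero x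
    simp [ψ, h0, hrv]
  rw [← hf, ← hψ, ← Ext.mk₀_comp_mk₀, hS.extClass_comp_assoc]

end ExtOne

/-! ### The quiver `Q1`: the two-term complex and the Euler form. -/

section Triangle
open Limits Abelian
universe w
variable {k : Type u} [Field k]

/-- The linear map along `b ⟶ e`. -/
abbrev actBE (X : Rep k Q1) : X.obj Q1.b →ₗ[k] X.obj Q1.e :=
  act X (i := Q1.b) (j := Q1.e) Q1.Arrow.be

/-- The linear map along `b ⟶ mid`. -/
abbrev actBM (X : Rep k Q1) : X.obj Q1.b →ₗ[k] X.obj Q1.mid :=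
  act X (i := Q1.b) (j := Q1.mid) Q1.Arrow.bm

/-- The linear map along `mid ⟶ e`. -/
abbrev actME (X : Rep k Q1) : X.obj Q1.mid →ₗ[k] X.obj Q1.e :=
  act X (i := Q1.mid) (j := Q1.e) Q1.Arrow.me

lemma comp_actBE {X Y : Rep k Q1} (φ : X ⟶ Y) :
    comp φ Q1.e ∘ₗ actBE X = actBE Y ∘ₗ comp φ Q1.b := comp_act φ _

lemma comp_actBM {X Y : Rep k Q1} (φ : X ⟶ Y) :
    comp φ Q1.mid ∘ₗ actBM X = actBM Y ∘ₗ comp φ Q1.b := comp_act φ _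

lemma comp_actME {X Y : Rep k Q1} (φ : X ⟶ Y) :
    comp φ Q1.e ∘ₗ actME X = actME Y ∘ₗ comp φ Q1.mid := comp_act φ _

/-- The family of linear maps with given components at the three vertices. -/
def comps {X Y : Rep k Q1} (ub : X.obj Q1.b →ₗ[k] Y.obj Q1.b)
    (um : X.obj Q1.mid →ₗ[k] Y.obj Q1.mid) (ue : X.obj Q1.e →ₗ[k] Y.obj Q1.e) :
    ∀ v : Q1, X.obj v →ₗ[k] Y.obj v
  | Q1.b => ub
  | Q1.mid => um
  | Q1.e => ue

/-- A morphism of representations of `Q₁` from its components. -/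
def homMk₃ {X Y : Rep k Q1} (ub : X.obj Q1.b →ₗ[k] Y.obj Q1.b)
    (um : X.obj Q1.mid →ₗ[k] Y.obj Q1.mid) (ue : X.obj Q1.e →ₗ[k] Y.obj Q1.e)
    (hbe : ue ∘ₗ actBE X = actBE Y ∘ₗ ub) (hbm : um ∘ₗ actBM X = actBM Y ∘ₗ ub)
    (hme : ue ∘ₗ actME X = actME Y ∘ₗ um) : X ⟶ Y :=
  homMk (comps ub um ue) fun {i j} a => match i, j, a with
    | _, _, Q1.Arrow.be => hbe
    | _, _, Q1.Arrow.bm => hbm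
    | _, _, Q1.Arrow.me => hme

lemma forall_Q1 {p : Q1 → Prop} : (∀ v, p v) ↔ p Q1.b ∧ p Q1.mid ∧ p Q1.e :=
  ⟨fun h => ⟨h _, h _, h _⟩, fun h v => by cases v; exacts [h.1, h.2.1, h.2.2]⟩

lemma hom_ext₃ {X Y : Rep k Q1} {φ ψ : X ⟶ Y} (hb : comp φ Q1.b = comp ψ Q1.b)
    (hm : comp φ Q1.mid = comp ψ Q1.mid) (he : comp φ Q1.e = comp ψ Q1.e) : φ = ψ :=
  hom_ext (forall_Q1.2 ⟨hb, hm, he⟩)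

/-- The differential of the complex computing `Hom(X, Y)` and `Ext¹(X, Y)`. -/
def diff (X Y : Rep k Q1) :
    ((X.obj Q1.b →ₗ[k] Y.obj Q1.b) × (X.obj Q1.mid →ₗ[k] Y.obj Q1.mid) ×
      (X.obj Q1.e →ₗ[k] Y.obj Q1.e)) →ₗ[k]
    ((X.obj Q1.b →ₗ[k] Y.obj Q1.e) × (X.obj Q1.b →ₗ[k] Y.obj Q1.mid) ×
      (X.obj Q1.mid →ₗ[k] Y.obj Q1.e)) where
  toFun t := (actBE Y ∘ₗ t.1 - t.2.2 ∘ₗ actBE X, actBM Y ∘ₗ t.1 - t.2.1 ∘ₗ actBM X,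
    actME Y ∘ₗ t.2.1 - t.2.2 ∘ₗ actME X)
  map_add' s t := by
    simp only [Prod.fst_add, Prod.snd_add, LinearMap.comp_add, LinearMap.add_comp, Prod.mk_add_mk]
    refine Prod.ext ?_ (Prod.ext ?_ ?_) <;> simp only [] <;> abel
  map_smul' c t := by
    simp only [Prod.smul_fst, Prod.smul_snd, LinearMap.comp_smul, LinearMap.smul_comp,
      Prod.smul_mk, smul_sub, RingHom.id_apply]

lemma cobSurj_iff (X Y : Rep k Q1) : CobSurj X Y ↔ Function.Surjective (diff X Y) := by
  constructor
  · rintro h ⟨cf, cg, ch⟩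
    obtain ⟨t, ht⟩ := h fun i j a => match i, j, a with
      | _, _, Q1.Arrow.be => cf
      | _, _, Q1.Arrow.bm => cg
      | _, _, Q1.Arrow.me => ch
    exact ⟨(t Q1.b, t Q1.mid, t Q1.e), Prod.ext (ht _ _ Q1.Arrow.be).symm
      (Prod.ext (ht _ _ Q1.Arrow.bm).symm (ht _ _ Q1.Arrow.me).symm)⟩
  · intro h c
    obtain ⟨⟨tb, tm, te⟩, ht⟩ := h (c _ _ Q1.Arrow.be, c _ _ Q1.Arrow.bm, c _ _ Q1.Arrow.me)
    refine ⟨comps tb tm te, fun i j a => ?_⟩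
    exact match i, j, a with
    | _, _, Q1.Arrow.be => (congrArg Prod.fst ht).symm
    | _, _, Q1.Arrow.bm => (congrArg (fun p => p.2.1) ht).symm
    | _, _, Q1.Arrow.me => (congrArg (fun p => p.2.2) ht).symm

/-- Morphisms are the kernel of the differential. -/
def homEquivKer (X Y : Rep k Q1) : (X ⟶ Y) ≃ₗ[k] LinearMap.ker (diff X Y) where
  toFun φ := ⟨(comp φ Q1.b, comp φ Q1.mid, comp φ Q1.e), by
    refine Prod.ext ?_ (Prod.ext ?_ ?_)
    · exact sub_eq_zero.2 (comp_act φ _).symm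
    · exact sub_eq_zero.2 (comp_act φ _).symm
    · exact sub_eq_zero.2 (comp_act φ _).symm⟩
  map_add' _ _ := rfl
  map_smul' _ _ := rfl
  invFun t := homMk₃ t.1.1 t.1.2.1 t.1.2.2
    (sub_eq_zero.1 (congrArg Prod.fst t.2)).symm
    (sub_eq_zero.1 (congrArg (fun p => p.2.1) t.2)).symm
    (sub_eq_zero.1 (congrArg (fun p => p.2.2) t.2)).symm
  left_inv _ := hom_ext₃ rfl rfl rfl
  right_inv _ := rfl

/-- The dimension vector. -/
def dimv (X : Rep k Q1) (v : Q1) : ℤ := Module.finrank k (X.obj v)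

/-- The Euler form. -/
def eul (x y : Q1 → ℤ) : ℤ :=
  x Q1.b * y Q1.b + x Q1.mid * y Q1.mid + x Q1.e * y Q1.e
    - x Q1.b * y Q1.e - x Q1.b * y Q1.mid - x Q1.mid * y Q1.e

/-- Rank–nullity for `diff`: the Euler form is the dimension of its source minus that of its target,
and `n` is the dimension of its cokernel. -/
lemma finrank_hom_eq (X Y : Rep k Q1) :
    ∃ n : ℕ, (Module.finrank k (X ⟶ Y) : ℤ) = eul (dimv X) (dimv Y) + n ∧
      (n = 0 ↔ CobSurj X Y) := by
  have h1 := LinearMap.finrank_range_add_finrank_ker (diff X Y)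
  rw [← (homEquivKer X Y).finrank_eq] at h1
  have h2 := Submodule.finrank_le (LinearMap.range (diff X Y))
  obtain ⟨n, hn⟩ := Nat.exists_eq_add_of_le h2
  refine ⟨n, ?_, ?_⟩
  rotate_left
  · rw [cobSurj_iff, ← LinearMap.range_eq_top]
    refine ⟨fun h0 => Submodule.eq_top_of_finrank_eq (by omega), fun h => ?_⟩
    rw [h, finrank_top] at hn
    omega
  · simp only [Module.finrank_prod, Module.finrank_linearMap] at h1 hn
    zify at h1 hn
    unfold eul dimv
    linarith

lemma eul_le_finrank (X Y : Rep k Q1) :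
    eul (dimv X) (dimv Y) ≤ Module.finrank k (X ⟶ Y) := by
  obtain ⟨n, hn, -⟩ := finrank_hom_eq X Y
  omega

lemma finrank_eq_eul_iff (X Y : Rep k Q1) :
    (Module.finrank k (X ⟶ Y) : ℤ) = eul (dimv X) (dimv Y) ↔ CobSurj X Y := by
  obtain ⟨n, hn, hn'⟩ := finrank_hom_eq X Y
  rw [← hn']
  omega

instance (X Y : Rep k Q1) : Module.Finite k (X ⟶ Y) :=
  Module.Finite.equiv (homEquivKer X Y).symm

lemma exists_hom_ne_zero {X Y : Rep k Q1} (h : 0 < eul (dimv X) (dimv Y)) :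
    ∃ φ : X ⟶ Y, φ ≠ 0 := by
  have h1 : 0 < Module.finrank k (X ⟶ Y) := by
    have := eul_le_finrank X Y
    omega
  have := Module.nontrivial_of_finrank_pos h1
  exact exists_ne 0

lemma dimv_eq_of_iso {X Y : Rep k Q1} (i : X ≅ Y) : dimv X = dimv Y := by
  funext v
  have := (isIso_iff i.hom).1 inferInstance v
  exact congrArg Nat.cast (LinearEquiv.ofBijective (comp i.hom v) this).finrank_eq

variable {nb nm ne : ℕ} (f : (Fin nb → k) →ₗ[k] (Fin ne → k))
    (g : (Fin nb → k) →ₗ[k] (Fin nm → k)) (h : (Fin nm → k) →ₗ[k] (Fin ne → k))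

@[simp] lemma actBE_mkRep : actBE (mkRep k f g h) = f := by
  unfold actBE act mkRep
  rw [Paths.lift_toPath]
  rfl

@[simp] lemma actBM_mkRep : actBM (mkRep k f g h) = g := by
  unfold actBM act mkRep
  rw [Paths.lift_toPath]
  rfl

@[simp] lemma actME_mkRep : actME (mkRep k f g h) = h := by
  unfold actME act mkRep
  rw [Paths.lift_toPath]
  rfl

lemma dimv_mkRep : dimv (mkRep k f g h) Q1.b = nb ∧ dimv (mkRep k f g h) Q1.mid = nm ∧
    dimv (mkRep k f g h) Q1.e = ne := by
  refine ⟨?_, ?_, ?_⟩ <;> exact congrArg Nat.cast (Module.finrank_fin_fun k)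

variable {f g h}

/-- A morphism from `mkRep` from its components. -/
def fromMkRep {X : Rep k Q1} (ub : (Fin nb → k) →ₗ[k] X.obj Q1.b)
    (um : (Fin nm → k) →ₗ[k] X.obj Q1.mid) (ue : (Fin ne → k) →ₗ[k] X.obj Q1.e)
    (hbe : ue ∘ₗ f = actBE X ∘ₗ ub) (hbm : um ∘ₗ g = actBM X ∘ₗ ub)
    (hme : ue ∘ₗ h = actME X ∘ₗ um) : mkRep k f g h ⟶ X :=
  homMk₃ ub um ue (by rw [actBE_mkRep]; exact hbe) (by rw [actBM_mkRep]; exact hbm)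
    (by rw [actME_mkRep]; exact hme)

/-- A morphism between two `mkRep` from its components. -/
def mkRepHom {nb' nm' ne' : ℕ} {f' : (Fin nb' → k) →ₗ[k] (Fin ne' → k)}
    {g' : (Fin nb' → k) →ₗ[k] (Fin nm' → k)} {h' : (Fin nm' → k) →ₗ[k] (Fin ne' → k)}
    (ub : (Fin nb → k) →ₗ[k] (Fin nb' → k)) (um : (Fin nm → k) →ₗ[k] (Fin nm' → k))
    (ue : (Fin ne → k) →ₗ[k] (Fin ne' → k))
    (hbe : ue ∘ₗ f = f' ∘ₗ ub) (hbm : um ∘ₗ g = g' ∘ₗ ub)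
    (hme : ue ∘ₗ h = h' ∘ₗ um) : mkRep k f g h ⟶ mkRep k f' g' h' :=
  fromMkRep (X := mkRep k f' g' h') ub um ue (by rw [actBE_mkRep]; exact hbe) (by rw [actBM_mkRep]; exact hbm)
    (by rw [actME_mkRep]; exact hme)

/-- A morphism between two `mkRep`, as three linear maps. -/
lemma mkRepHom_cases {nb' nm' ne' : ℕ} {f' : (Fin nb' → k) →ₗ[k] (Fin ne' → k)}
    {g' : (Fin nb' → k) →ₗ[k] (Fin nm' → k)} {h' : (Fin nm' → k) →ₗ[k] (Fin ne' → k)}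
    (φ : mkRep k f g h ⟶ mkRep k f' g' h') :
    ∃ (ub : (Fin nb → k) →ₗ[k] (Fin nb' → k)) (um : (Fin nm → k) →ₗ[k] (Fin nm' → k))
      (ue : (Fin ne → k) →ₗ[k] (Fin ne' → k)) (hbe : ue ∘ₗ f = f' ∘ₗ ub)
      (hbm : um ∘ₗ g = g' ∘ₗ ub) (hme : ue ∘ₗ h = h' ∘ₗ um),
      φ = mkRepHom ub um ue hbe hbm hme := by
  refine ⟨comp φ Q1.b, comp φ Q1.mid, comp φ Q1.e, ?_, ?_, ?_, hom_ext₃ rfl rfl rfl⟩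
  · have := comp_actBE φ
    rwa [actBE_mkRep, actBE_mkRep] at this
  · have := comp_actBM φ
    rwa [actBM_mkRep, actBM_mkRep] at this
  · have := comp_actME φ
    rwa [actME_mkRep, actME_mkRep] at this

end Triangle

/-! ### Short exact sequences linking the listed objects. -/

section Sequences
open Limits Abelian
universe w
variable {k : Type u} [Field k]

/-- There is a short exact sequence `0 ⟶ X ⟶ Y ⟶ Z ⟶ 0`. -/
def HasSES (X Y Z : Rep k Q1) : Prop :=
  ∃ (f : X ⟶ Y) (g : Y ⟶ Z) (w : f ≫ g = 0), (ShortComplex.mk f g w).ShortExact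

/-- Short exactness of a pair of linear maps. -/
def LinSES {U V W : Type*} [AddCommGroup U] [AddCommGroup V] [AddCommGroup W] [Module k U]
    [Module k V] [Module k W] (f : U →ₗ[k] V) (g : V →ₗ[k] W) : Prop :=
  Function.Injective f ∧ Function.Surjective g ∧ Function.Exact f g

lemma linSES_id_right {V : Type*} [AddCommGroup V] [Module k V] :
    LinSES (0 : (Fin 0 → k) →ₗ[k] V) LinearMap.id :=
  ⟨Function.injective_of_subsingleton _, Function.surjective_id, fun y =>
    ⟨fun h => ⟨0, by simpa using h.symm⟩, by rintro ⟨x, rfl⟩; rfl⟩⟩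

lemma linSES_id_left {V : Type*} [AddCommGroup V] [Module k V] :
    LinSES LinearMap.id (0 : V →ₗ[k] (Fin 0 → k)) :=
  ⟨Function.injective_id, Function.surjective_to_subsingleton _, fun y => by simp⟩

variable (k) in
/-- `c ↦ (c, 0, …, 0)` -/
def emb (m : ℕ) : (Fin 1 → k) →ₗ[k] (Fin (m + 1) → k) where
  toFun c := Fin.cons (α := fun _ => k) (c 0) 0
  map_add' x y := by
    ext i
    refine Fin.cases ?_ (fun j => ?_) i <;> simp
  map_smul' c x := by
    ext i
    refine Fin.cases ?_ (fun j => ?_) i <;> simp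

variable (k) in
/-- `(a₁, …, aₘ₊₁) ↦ a₁` -/
def fst (m : ℕ) : (Fin (m + 1) → k) →ₗ[k] (Fin 1 → k) where
  toFun a := fun _ => a 0
  map_add' _ _ := rfl
  map_smul' _ _ := rfl

lemma linSES_emb (m : ℕ) : LinSES (emb k m) (piMinus k m) := by
  refine ⟨fun x y h => ?_, fun y => ⟨Fin.cons 0 y, by ext i; simp [piMinus]⟩, fun y => ⟨fun h => ?_, ?_⟩⟩
  · ext i
    rw [Subsingleton.elim i 0]
    simpa [emb] using congrFun h 0
  · refine ⟨fun _ => y 0, ?_⟩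
    ext i
    refine Fin.cases ?_ (fun j => ?_) i
    · simp [emb]
    · exact (congrFun h j).symm
  · rintro ⟨c, rfl⟩
    ext i
    simp [emb, piMinus]

lemma linSES_jMinus (m : ℕ) : LinSES (jMinus k m) (fst k m) := by
  refine ⟨fun x y h => ?_, fun y => ⟨fun _ => y 0, ?_⟩, fun y => ⟨fun h => ?_, ?_⟩⟩
  · ext i
    simpa [jMinus] using congrFun h i.succ
  · ext i
    rw [Subsingleton.elim i 0]
    simp [fst]
  · refine ⟨fun i => y i.succ, ?_⟩
    ext i
    refine Fin.cases ?_ (fun j => ?_) i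
    · exact (congrFun h 0).symm
    · simp [jMinus]
  · rintro ⟨c, rfl⟩
    ext i
    simp [fst, jMinus]

lemma hasSES_mkRep {nb nm ne nb' nm' ne' nb'' nm'' ne'' : ℕ}
    {f : (Fin nb → k) →ₗ[k] (Fin ne → k)} {g : (Fin nb → k) →ₗ[k] (Fin nm → k)}
    {h : (Fin nm → k) →ₗ[k] (Fin ne → k)} {f' : (Fin nb' → k) →ₗ[k] (Fin ne' → k)}
    {g' : (Fin nb' → k) →ₗ[k] (Fin nm' → k)} {h' : (Fin nm' → k) →ₗ[k] (Fin ne' → k)}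
    {f'' : (Fin nb'' → k) →ₗ[k] (Fin ne'' → k)} {g'' : (Fin nb'' → k) →ₗ[k] (Fin nm'' → k)}
    {h'' : (Fin nm'' → k) →ₗ[k] (Fin ne'' → k)}
    {ub : (Fin nb → k) →ₗ[k] (Fin nb' → k)} {um : (Fin nm → k) →ₗ[k] (Fin nm' → k)}
    {ue : (Fin ne → k) →ₗ[k] (Fin ne' → k)} {vb : (Fin nb' → k) →ₗ[k] (Fin nb'' → k)}
    {vm : (Fin nm' → k) →ₗ[k] (Fin nm'' → k)} {ve : (Fin ne' → k) →ₗ[k] (Fin ne'' → k)}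
    (hb : LinSES ub vb) (hm : LinSES um vm) (he : LinSES ue ve)
    (c1 : ue ∘ₗ f = f' ∘ₗ ub) (c2 : um ∘ₗ g = g' ∘ₗ ub) (c3 : ue ∘ₗ h = h' ∘ₗ um)
    (d1 : ve ∘ₗ f' = f'' ∘ₗ vb) (d2 : vm ∘ₗ g' = g'' ∘ₗ vb) (d3 : ve ∘ₗ h' = h'' ∘ₗ vm) :
    HasSES (mkRep k f g h) (mkRep k f' g' h') (mkRep k f'' g'' h'') :=
  ⟨_, _, shortExact_mk (mkRepHom ub um ue c1 c2 c3) (mkRepHom vb vm ve d1 d2 d3)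
    (forall_Q1.2 ⟨hb.1, hm.1, he.1⟩) (forall_Q1.2 ⟨hb.2.1, hm.2.1, he.2.1⟩)
    (forall_Q1.2 ⟨hb.2.2, hm.2.2, he.2.2⟩)⟩

variable (k)

lemma jMinus_comp_jPlus (m : ℕ) :
    jMinus k (m + 1) ∘ₗ jPlus k m = jPlus k (m + 1) ∘ₗ jMinus k m := by
  ext a i
  exact congrFun (Fin.cons_snoc_eq_snoc_cons (β := k) 0 _ 0) i

lemma hasSES_M_E₄_E₁ (m : ℕ) : HasSES (M k) (E₄ k m) (E₁ k m) := by
  refine hasSES_mkRep (ub := 0) (um := emb k m) (ue := 0) (vb := LinearMap.id)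
    (vm := piMinus k m) (ve := LinearMap.id) linSES_id_right (linSES_emb m) linSES_id_right
    (by simp) (by simp) ?_ rfl rfl rfl
  exact LinearMap.ext fun c => ((linSES_emb m).2.2.apply_apply_eq_zero c).symm

lemma hasSES_E₃_E₂_M (m : ℕ) : HasSES (E₃ k m) (E₂ k m) (M k) := by
  refine hasSES_mkRep (ub := LinearMap.id) (um := jMinus k m) (ue := LinearMap.id) (vb := 0)
    (vm := fst k m) (ve := 0) linSES_id_left (linSES_jMinus m) linSES_id_left
    rfl rfl rfl (by simp) ?_ (by simp)
  exact LinearMap.ext fun c => (linSES_jMinus m).2.2.apply_apply_eq_zero c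

lemma hasSES_M'_E₁_E₄ (m : ℕ) : HasSES (M' k) (E₁ k (m + 1)) (E₄ k m) := by
  refine hasSES_mkRep (ub := emb k (m + 1)) (um := 0) (ue := emb k m) (vb := piMinus k (m + 1))
    (vm := LinearMap.id) (ve := piMinus k m) (linSES_emb _) linSES_id_right (linSES_emb _)
    ?_ ?_ (by simp) rfl rfl rfl
  · refine LinearMap.ext fun c => ?_
    ext i
    refine Fin.cases ?_ (fun j => ?_) i <;> simp [emb, piPlus]
  · exact LinearMap.ext fun c => ((linSES_emb _).2.2.apply_apply_eq_zero c).symm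

lemma hasSES_E₂_E₃_M' (m : ℕ) : HasSES (E₂ k m) (E₃ k (m + 1)) (M' k) := by
  refine hasSES_mkRep (ub := jMinus k m) (um := LinearMap.id) (ue := jMinus k (m + 1))
    (vb := fst k m) (vm := 0) (ve := fst k (m + 1)) (linSES_jMinus _) linSES_id_left
    (linSES_jMinus _) (jMinus_comp_jPlus k m) rfl rfl ?_ (by simp) ?_
  · refine LinearMap.ext fun c => ?_
    ext i
    exact Fin.snoc_castSucc (α := fun _ => k) 0 c 0
  · exact LinearMap.ext fun c => (linSES_jMinus _).2.2.apply_apply_eq_zero c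

/-- The link between the `E₁` and `E₃` families: `M'` is an extension of the simple at `b` by the
simple at `e`. -/
lemma hasSES_E₃_M'_E₁ : HasSES (E₃ k 0) (M' k) (E₁ k 0) := by
  refine hasSES_mkRep (ub := 0) (um := 0) (ue := LinearMap.id) (vb := LinearMap.id)
    (vm := LinearMap.id) (ve := 0) linSES_id_right linSES_id_right linSES_id_left ?_ ?_ ?_ ?_ ?_ ?_
  all_goals first | exact LinearMap.ext fun _ => Subsingleton.elim _ _ | skip
  all_goals exact LinearMap.ext fun c => by rw [Subsingleton.elim c 0, map_zero, map_zero]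

end Sequences

/-! ### Simples, projectives and global dimension one. -/

section Resolutions
open Limits Abelian
universe w
variable {k : Type u} [Field k]

/-- `c ↦ c • x` -/
def span₁ {V : Type*} [AddCommGroup V] [Module k V] (x : V) : (Fin 1 → k) →ₗ[k] V :=
  LinearMap.toSpanSingleton k V x ∘ₗ LinearMap.proj 0

lemma span₁_injective {V : Type*} [AddCommGroup V] [Module k V] {x : V} (hx : x ≠ 0) :
    Function.Injective (span₁ (k := k) x) := by
  intro c d h
  ext i
  rw [Subsingleton.elim i 0]
  exact smul_left_injective k hx h

lemma linearMap_ext_of_subsingleton {V W : Type*} [AddCommGroup V] [Module k V] [AddCommGroup W]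
    [Module k W] [Subsingleton W] (f g : V →ₗ[k] W) : f = g :=
  LinearMap.ext fun _ => Subsingleton.elim _ _

lemma linearMap_ext_of_zero {W : Type*} [AddCommGroup W]
    [Module k W] (f g : (Fin 0 → k) →ₗ[k] W) : f = g :=
  LinearMap.ext fun c => by rw [Subsingleton.elim c 0, map_zero, map_zero]

/-- A vector at a vertex spans a subrepresentation as soon as the spaces at the targets of all
outgoing arrows are zero; hence the order `e`, `mid`, `b`. -/
lemma exists_mono_of_nonzero {X : Rep k Q1} (hX : ¬ IsZero X) :
    ∃ S : Rep k Q1, (S = E₁ k 0 ∨ S = M k ∨ S = E₃ k 0) ∧ ∃ φ : S ⟶ X, Mono φ := by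
  by_cases he : Subsingleton (X.obj Q1.e)
  · by_cases hm : Subsingleton (X.obj Q1.mid)
    · by_cases hb : Subsingleton (X.obj Q1.b)
      · exact absurd ((isZero_iff X).2 (forall_Q1.2 ⟨hb, hm, he⟩)) hX
      · rw [not_subsingleton_iff_nontrivial] at hb
        obtain ⟨x, hx⟩ := exists_ne (0 : X.obj Q1.b)
        refine ⟨_, Or.inl rfl, fromMkRep (span₁ x) 0 0 (linearMap_ext_of_subsingleton _ _)
          (linearMap_ext_of_subsingleton _ _) (linearMap_ext_of_subsingleton _ _), ?_⟩
        exact (mono_iff _).2 (forall_Q1.2 ⟨span₁_injective hx,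
          Function.injective_of_subsingleton (α := Fin 0 → k) _,
          Function.injective_of_subsingleton (α := Fin 0 → k) _⟩)
    · rw [not_subsingleton_iff_nontrivial] at hm
      obtain ⟨x, hx⟩ := exists_ne (0 : X.obj Q1.mid)
      refine ⟨_, Or.inr (Or.inl rfl), fromMkRep 0 (span₁ x) 0 (linearMap_ext_of_subsingleton _ _)
        (linearMap_ext_of_zero _ _) (linearMap_ext_of_subsingleton _ _), ?_⟩
      exact (mono_iff _).2 (forall_Q1.2 ⟨Function.injective_of_subsingleton (α := Fin 0 → k) _,
        span₁_injective hx, Function.injective_of_subsingleton (α := Fin 0 → k) _⟩)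
  · rw [not_subsingleton_iff_nontrivial] at he
    obtain ⟨x, hx⟩ := exists_ne (0 : X.obj Q1.e)
    refine ⟨_, Or.inr (Or.inr rfl), fromMkRep 0 0 (span₁ x) (linearMap_ext_of_zero _ _)
      (linearMap_ext_of_zero _ _) (linearMap_ext_of_zero _ _), ?_⟩
    exact (mono_iff _).2 (forall_Q1.2 ⟨Function.injective_of_subsingleton (α := Fin 0 → k) _,
      Function.injective_of_subsingleton (α := Fin 0 → k) _, span₁_injective hx⟩)

/-- A property of representations that is stable under extensions and holds for the simple
representations holds for all representations. -/
theorem rep_induction {P : Rep k Q1 → Prop} (hzero : ∀ X, IsZero X → P X)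
    (hses : ∀ S : ShortComplex (Rep k Q1), S.ShortExact → P S.X₁ → P S.X₃ → P S.X₂)
    (hb : P (E₁ k 0)) (hm : P (M k)) (he : P (E₃ k 0)) (X : Rep k Q1) : P X := by
  -- Induction on the total dimension, splitting off a simple subobject.
  let d (X : Rep k Q1) : ℕ := Module.finrank k (X.obj Q1.b) + Module.finrank k (X.obj Q1.mid) +
    Module.finrank k (X.obj Q1.e)
  have hd0 : ∀ X, d X = 0 → IsZero X := fun X h => (isZero_iff X).2 (by
    refine forall_Q1.2 ⟨?_, ?_, ?_⟩ <;> rw [← Module.finrank_eq_zero_iff_of_free (R := k)] <;>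
      grind)
  induction hn : d X using Nat.strong_induction_on generalizing X with
  | h n ih =>
    by_cases hX : IsZero X
    · exact hzero X hX
    · obtain ⟨S, hS, φ, hφ⟩ := exists_mono_of_nonzero hX
      have hse : (ShortComplex.mk φ (cokernel.π φ) (cokernel.condition φ)).ShortExact :=
        { exact := ShortComplex.exact_cokernel φ }
      have hPS : P S := by rcases hS with rfl | rfl | rfl <;> assumption
      have hdS : 0 < d S := by
        rw [Nat.pos_iff_ne_zero]
        intro h
        have h1 := (isZero_iff S).1 (hd0 S h)
        have h2 : ∀ n, ¬ Subsingleton (Fin (n + 1) → k) := fun n => not_subsingleton _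
        rcases hS with rfl | rfl | rfl
        exacts [h2 _ (h1 Q1.b), h2 _ (h1 Q1.mid), h2 _ (h1 Q1.e)]
      have hadd : d S + d (cokernel φ) = d X := by
        have h1 := hse.finrank_add Q1.b
        have h2 := hse.finrank_add Q1.mid
        have h3 := hse.finrank_add Q1.e
        simp only [d]
        dsimp only at h1 h2 h3
        rw [← h1, ← h2, ← h3]
        abel
      exact hses _ hse hPS (ih (d (cokernel φ)) (by omega) _ rfl)

lemma exists_section {X Y : Rep k Q1} (φ : X ⟶ Y) [Epi φ] (v : Q1) :
    ∃ s : Y.obj v →ₗ[k] X.obj v, comp φ v ∘ₗ s = LinearMap.id :=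
  (comp φ v).exists_rightInverse_of_surjective (LinearMap.range_eq_top.2 ((epi_iff φ).1 ‹_› v))

instance projective_E₃_zero : Projective (E₃ k 0) where
  factors {X Y} f e he := by
    obtain ⟨s, hs⟩ := exists_section e Q1.e
    refine ⟨fromMkRep 0 0 (s ∘ₗ comp f Q1.e) (linearMap_ext_of_zero _ _)
      (linearMap_ext_of_zero _ _) (linearMap_ext_of_zero _ _), hom_ext₃
      (linearMap_ext_of_zero _ _) (linearMap_ext_of_zero _ _) ?_⟩
    change comp e Q1.e ∘ₗ s ∘ₗ comp f Q1.e = comp f Q1.e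
    rw [← LinearMap.comp_assoc, hs, LinearMap.id_comp]

/-- This is the representation freely generated by one vector at `mid`, so a lift is prescribed by a
preimage at that vertex. -/
instance projective_E₂_zero : Projective (E₂ k 0) where
  factors {X Y} f e he := by
    obtain ⟨s, hs⟩ := exists_section e Q1.mid
    refine ⟨fromMkRep 0 (s ∘ₗ comp f Q1.mid) (actME X ∘ₗ s ∘ₗ comp f Q1.mid)
      (linearMap_ext_of_zero _ _) (linearMap_ext_of_zero _ _) rfl, hom_ext₃
      (linearMap_ext_of_zero _ _) ?_ ?_⟩
    · change comp e Q1.mid ∘ₗ s ∘ₗ comp f Q1.mid = comp f Q1.mid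
      rw [← LinearMap.comp_assoc, hs, LinearMap.id_comp]
    · refine LinearMap.ext fun c => ?_
      have h1 : actME (E₂ k 0) = LinearMap.id := actME_mkRep ..
      have h2 := LinearMap.congr_fun (comp_actME f) c
      rw [h1] at h2
      exact (comp_act_apply e _ _).trans
        ((congrArg (actME Y) (LinearMap.congr_fun hs (comp f Q1.mid c))).trans h2.symm)

/-- Freely generated by one vector at `b`: its two-dimensional space at `e` has one coordinate for
each path from `b` to `e`, `jPlus` for the arrow and `jMinus` for the path through `mid`. -/
instance projective_E₃_one : Projective (E₃ k 1) where
  factors {X Y} f e he := by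
    obtain ⟨s, hs⟩ := exists_section e Q1.b
    let p₀ : (Fin 2 → k) →ₗ[k] (Fin 1 → k) := piPlus k 1
    let p₁ : (Fin 2 → k) →ₗ[k] (Fin 1 → k) := piMinus k 1
    have h₀₀ : p₀ ∘ₗ jPlus k 1 = LinearMap.id := by
      refine LinearMap.ext fun c => ?_
      ext i
      exact Fin.snoc_castSucc (α := fun _ => k) 0 c i
    have h₁₁ : p₁ ∘ₗ jMinus k 1 = LinearMap.id := rfl
    have h₀₁ : p₀ ∘ₗ jMinus k 1 = 0 := by
      refine LinearMap.ext fun c => ?_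
      ext i
      rw [Subsingleton.elim i 0]
      rfl
    have h₁₀ : p₁ ∘ₗ jPlus k 1 = 0 := by
      refine LinearMap.ext fun c => ?_
      ext i
      rw [Subsingleton.elim i 0]
      exact Fin.snoc_last (α := fun _ => k) 0 c
    have hid : jPlus k 1 ∘ₗ p₀ + jMinus k 1 ∘ₗ p₁ = LinearMap.id := by
      refine LinearMap.ext fun c => ?_
      ext i
      fin_cases i
      · have := congrFun (LinearMap.congr_fun h₀₀ (p₀ c)) 0
        have h2 := congrFun (LinearMap.congr_fun h₀₁ (p₁ c)) 0
        exact (congrArg₂ (· + ·) this h2).trans (add_zero _)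
      · have := congrFun (LinearMap.congr_fun h₁₀ (p₀ c)) 0
        exact (congrArg₂ (· + ·) this rfl).trans (zero_add _)
    have hB : ∀ c, comp e Q1.b (s (comp f Q1.b c)) = comp f Q1.b c := fun c =>
      LinearMap.congr_fun hs (comp f Q1.b c)
    have e₁ : actBE (E₃ k 1) = jPlus k 1 := actBE_mkRep ..
    have e₂ : actBM (E₃ k 1) = LinearMap.id := actBM_mkRep ..
    have e₃ : actME (E₃ k 1) = jMinus k 1 := actME_mkRep ..
    have fBE : ∀ c, comp f Q1.e (jPlus k 1 c) = actBE Y (comp f Q1.b c) := fun c => by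
      have := LinearMap.congr_fun (comp_actBE f) c
      rw [e₁] at this
      exact this
    have fBM : ∀ c, comp f Q1.mid c = actBM Y (comp f Q1.b c) := fun c => by
      have := LinearMap.congr_fun (comp_actBM f) c
      rw [e₂] at this
      exact this
    have fME : ∀ c, comp f Q1.e (jMinus k 1 c) = actME Y (comp f Q1.mid c) := fun c => by
      have := LinearMap.congr_fun (comp_actME f) c
      rw [e₃] at this
      exact this
    let ub : (Fin 1 → k) →ₗ[k] X.obj Q1.b := s ∘ₗ comp f Q1.b
    refine ⟨fromMkRep ub (actBM X ∘ₗ ub)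
      ((actBE X ∘ₗ ub) ∘ₗ p₀ + (actME X ∘ₗ actBM X ∘ₗ ub) ∘ₗ p₁) ?_ rfl ?_,
      hom_ext₃ (LinearMap.ext hB) (LinearMap.ext fun c => ?_) (LinearMap.ext fun c => ?_)⟩
    · rw [LinearMap.add_comp, LinearMap.comp_assoc, LinearMap.comp_assoc _ p₁, h₀₀, h₁₀]
      simp
    · rw [LinearMap.add_comp, LinearMap.comp_assoc, LinearMap.comp_assoc _ p₁, h₀₁, h₁₁]
      simp
    · exact (comp_act_apply e _ _).trans ((congrArg (actBM Y) (hB c)).trans (fBM c).symm)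
    · refine ((comp e Q1.e).map_add _ _).trans ?_
      refine Eq.trans ?_ (congrArg (comp f Q1.e) (LinearMap.congr_fun hid c))
      refine Eq.trans ?_ ((comp f Q1.e).map_add _ _).symm
      refine congrArg₂ (· + ·) ?_ ?_
      · exact (comp_act_apply e _ _).trans ((congrArg (actBE Y) (hB _)).trans (fBE _).symm)
      · exact (comp_act_apply e _ _).trans ((congrArg (actME Y) ((comp_act_apply e _ _).trans
          ((congrArg (actBM Y) (hB _)).trans (fBM _).symm))).trans (fME _).symm)

/-- The bound passes to extensions, so the simples suffice. The simple at `b` is reached through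
`M'`, which is the quotient of the projective `E₃ k 1` by the projective `E₂ k 0`. -/
lemma hasProjectiveDimensionLT_two (X : Rep k Q1) : HasProjectiveDimensionLT X 2 := by
  obtain ⟨f₁, g₁, w₁, h₁⟩ := hasSES_E₂_E₃_M' k 0
  obtain ⟨f₂, g₂, w₂, h₂⟩ := hasSES_E₃_M'_E₁ k
  obtain ⟨f₃, g₃, w₃, h₃⟩ := hasSES_E₃_E₂_M k 0
  have hM' : HasProjectiveDimensionLT (M' k) 2 :=
    h₁.hasProjectiveDimensionLT_X₃ 1 (inferInstanceAs (HasProjectiveDimensionLT (E₂ k 0) 1))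
      (inferInstanceAs (HasProjectiveDimensionLT (E₃ k 1) 2))
  refine rep_induction (P := fun X => HasProjectiveDimensionLT X 2)
    (fun X hX => ?_) (fun S hS h h' => hS.hasProjectiveDimensionLT_X₂ 2 h h') ?_ ?_ ?_ X
  · have := hX.hasProjectiveDimensionLT_zero
    exact hasProjectiveDimensionLT_of_ge X 0 2 (by omega)
  · exact h₂.hasProjectiveDimensionLT_X₃ 1 (inferInstanceAs (HasProjectiveDimensionLT (E₃ k 0) 1))
      hM'
  · exact h₃.hasProjectiveDimensionLT_X₃ 1 (inferInstanceAs (HasProjectiveDimensionLT (E₃ k 0) 1))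
      (inferInstanceAs (HasProjectiveDimensionLT (E₂ k 0) 2))
  · infer_instance

/-- The horseshoe step: it makes having a projective cover object stable under extensions. -/
lemma epi_biprod_desc {C : Type*} [Category* C] [Abelian C] {S : ShortComplex C}
    (hS : S.ShortExact) {P₁ P₃ : C} (p₁ : P₁ ⟶ S.X₁) [Epi p₁] (p₃ : P₃ ⟶ S.X₂)
    [Epi (p₃ ≫ S.g)] : Epi (biprod.desc (p₁ ≫ S.f) p₃) := by
  have := hS.epi_g
  refine Preadditive.epi_of_cancel_zero _ fun {T} t ht => ?_
  have h1 : S.f ≫ t = 0 := by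
    rw [← cancel_epi p₁, Limits.comp_zero, ← Category.assoc, ← biprod.inl_desc (p₁ ≫ S.f) p₃,
      Category.assoc, ht, Limits.comp_zero]
  have h3 : p₃ ≫ t = 0 := by
    rw [← biprod.inr_desc (p₁ ≫ S.f) p₃, Category.assoc, ht, Limits.comp_zero]
  have h4 := hS.exact.g_desc t h1
  rw [← h4, ← Category.assoc] at h3
  rw [← h4, zero_of_epi_comp _ h3, Limits.comp_zero]

instance : EnoughProjectives (Rep k Q1) where
  presentation := by
    have key : ∀ X : Rep k Q1, ∃ (P : Rep k Q1) (p : P ⟶ X), Projective P ∧ Epi p := by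
      refine rep_induction (fun X hX => ⟨X, 𝟙 X, ?_, inferInstance⟩) ?_ ?_ ?_ ?_
      · exact ⟨fun _ _ _ => ⟨0, hX.eq_of_src _ _⟩⟩
      · rintro S hS ⟨P₁, p₁, hP₁, hp₁⟩ ⟨P₃, p₃, hP₃, hp₃⟩
        have := hS.epi_g
        have hf := Projective.factorThru_comp p₃ S.g
        have : Epi (Projective.factorThru p₃ S.g ≫ S.g) := by rwa [hf]
        exact ⟨P₁ ⊞ P₃, biprod.desc (p₁ ≫ S.f) (Projective.factorThru p₃ S.g), inferInstance,
          epi_biprod_desc hS p₁ _⟩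
      · obtain ⟨f₁, g₁, w₁, h₁⟩ := hasSES_E₂_E₃_M' k 0
        obtain ⟨f₂, g₂, w₂, h₂⟩ := hasSES_E₃_M'_E₁ k
        have := h₁.epi_g
        have := h₂.epi_g
        exact ⟨E₃ k 1, g₁ ≫ g₂, inferInstance, epi_comp _ _⟩
      · obtain ⟨f₃, g₃, w₃, h₃⟩ := hasSES_E₃_E₂_M k 0
        exact ⟨E₂ k 0, g₃, inferInstance, h₃.epi_g⟩
      · exact ⟨E₃ k 0, 𝟙 _, inferInstance, inferInstance⟩
    intro X
    obtain ⟨P, p, hP, hp⟩ := key X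
    exact ⟨{ p := P, f := p, projective := hP, epi := hp }⟩

lemma subsingleton_ext_one_iff [HasExt.{w} (Rep k Q1)] (X Y : Rep k Q1) :
    Subsingleton (Ext X Y 1) ↔ CobSurj X Y := by
  refine ⟨cobSurj_of_subsingleton_ext, fun h => ?_⟩
  have hse : (ShortComplex.mk (kernel.ι (Projective.π X)) (Projective.π X)
      (kernel.condition _)).ShortExact := { exact := ShortComplex.exact_kernel _ }
  exact subsingleton_ext_of_cobSurj hse (inferInstanceAs (Projective (Projective.over X))) h

lemma subsingleton_ext_of_two_le [HasExt.{w} (Rep k Q1)] (X Y : Rep k Q1) {n : ℕ} (hn : 2 ≤ n) :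
    Subsingleton (Ext X Y n) :=
  have := hasProjectiveDimensionLT_two X
  HasProjectiveDimensionLT.subsingleton X 2 n hn Y

lemma subsingleton_ext_zero_iff [HasExt.{w} (Rep k Q1)] (X Y : Rep k Q1) :
    Subsingleton (Ext X Y 0) ↔ Subsingleton (X ⟶ Y) :=
  Ext.homEquiv₀.subsingleton_congr

end Resolutions

/-! ### Toeplitz matrices and the maps commuting with both shifts. -/

section Homs

section Toeplitz
variable {k : Type u}
lemma toeplitz_add {n m : ℕ} {T : ℕ → ℕ → k}
    (hT : ∀ i < n, ∀ j < m, T (i + 1) (j + 1) = T i j) (i j d : ℕ) (hi : i + d ≤ n)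
    (hj : j + d ≤ m) : T (i + d) (j + d) = T i j := by
  induction d with
  | zero => rfl
  | succ d ih =>
    rw [← ih (by omega) (by omega), ← hT (i + d) (by omega) (j + d) (by omega)]
    rfl

variable [Zero k]

/-- Slide up the diagonal to the first column. -/
lemma toeplitz_below {n m : ℕ} {T : ℕ → ℕ → k}
    (hT : ∀ i < n, ∀ j < m, T (i + 1) (j + 1) = T i j) (h₀ : ∀ i < n, T (i + 1) 0 = 0)
    {i j : ℕ} (hij : j < i) (hi : i ≤ n) (hj : j ≤ m) : T i j = 0 := by
  obtain ⟨d, rfl⟩ := Nat.exists_eq_add_of_lt hij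
  have := toeplitz_add hT (d + 1) 0 j (by omega) (by omega)
  rw [h₀ d (by omega)] at this
  rw [← this]
  congr 1 <;> omega

/-- Slide down the diagonal to the last column; `hij` says that it is met above the bottom row. -/
lemma toeplitz_above {n m : ℕ} {T : ℕ → ℕ → k}
    (hT : ∀ i < n, ∀ j < m, T (i + 1) (j + 1) = T i j) (h₁ : ∀ i < n, T i m = 0)
    {i j : ℕ} (hij : i + m < j + n) (hj : j ≤ m) : T i j = 0 := by
  obtain ⟨d, rfl⟩ := Nat.exists_eq_add_of_le hj
  have := toeplitz_add hT i j d (by omega) (by omega)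
  rw [← this, h₁ (i + d) (by omega)]

lemma toeplitz_fin {n m : ℕ} {T : Fin (n + 1) → Fin (m + 1) → k}
    (hT : ∀ i j, T (Fin.succ i) (Fin.succ j) = T i.castSucc j.castSucc)
    (h₀ : ∀ i, T (Fin.succ i) 0 = 0) (h₁ : ∀ i, T (Fin.castSucc i) (Fin.last m) = 0) :
    ∃ T' : ℕ → ℕ → k, (∀ i j, T i j = T' i j) ∧
    (∀ i < n, ∀ j < m, T' (i + 1) (j + 1) = T' i j) ∧ (∀ i < n, T' (i + 1) 0 = 0) ∧
    (∀ i < n, T' i m = 0) := by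
  refine ⟨fun i j => if h : i < n + 1 ∧ j < m + 1 then T ⟨i, h.1⟩ ⟨j, h.2⟩ else 0,
    fun i j => by
      dsimp only
      rw [dif_pos ⟨i.2, j.2⟩], fun i hi j hj => ?_, fun i hi => ?_, fun i hi => ?_⟩
  · refine (dif_pos ⟨by omega, by omega⟩).trans (Eq.trans ?_ (dif_pos ⟨by omega, by omega⟩).symm)
    exact hT ⟨i, hi⟩ ⟨j, hj⟩
  · exact (dif_pos ⟨by omega, by omega⟩).trans (h₀ ⟨i, hi⟩)
  · exact (dif_pos ⟨by omega, by omega⟩).trans (h₁ ⟨i, hi⟩)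

/-- With exactly one row more than columns, the two vanishing regions j < i and i ≤ j cover the
matrix. For a square matrix they leave only the main diagonal. -/
lemma toeplitz_eq_zero {n m : ℕ} {T : Fin (n + 1) → Fin (m + 1) → k}
    (hT : ∀ i j, T (Fin.succ i) (Fin.succ j) = T i.castSucc j.castSucc)
    (h₀ : ∀ i, T (Fin.succ i) 0 = 0) (h₁ : ∀ i, T (Fin.castSucc i) (Fin.last m) = 0)
    (hnm : n = m + 1) : T = 0 := by
  obtain ⟨T', hTT', h1, h2, h3⟩ := toeplitz_fin hT h₀ h₁
  funext i j
  rw [hTT']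
  by_cases h : (j : ℕ) < i
  · exact toeplitz_below h1 h2 h (by omega) (by omega)
  · exact toeplitz_above h1 h3 (by omega) (by omega)

lemma toeplitz_eq_ite {n m : ℕ} {T : Fin (n + 1) → Fin (m + 1) → k}
    (hT : ∀ i j, T (Fin.succ i) (Fin.succ j) = T i.castSucc j.castSucc)
    (h₀ : ∀ i, T (Fin.succ i) 0 = 0) (h₁ : ∀ i, T (Fin.castSucc i) (Fin.last m) = 0)
    (hnm : n = m) : ∃ c : k, ∀ i j, T i j = if (i : ℕ) = j then c else 0 := by
  obtain ⟨T', hTT', h1, h2, h3⟩ := toeplitz_fin hT h₀ h₁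
  refine ⟨T' 0 0, fun i j => ?_⟩
  rw [hTT']
  split_ifs with hij
  · rw [← hij]
    simpa using toeplitz_add h1 0 0 i (by omega) (by omega)
  · by_cases h : (j : ℕ) < i
    · exact toeplitz_below h1 h2 h (by omega) (by omega)
    · exact toeplitz_above h1 h3 (by omega) (by omega)

end Toeplitz

variable {k : Type u} [Field k]

lemma piPlus_surjective (m : ℕ) : Function.Surjective (piPlus k m) := fun y =>
  ⟨Fin.snoc (α := fun _ => k) y 0, by ext i; simp [piPlus]⟩

lemma piMinus_surjective (m : ℕ) : Function.Surjective (piMinus k m) := (linSES_emb m).2.1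

lemma jPlus_injective (m : ℕ) : Function.Injective (jPlus k m) := fun x y h => by
  ext i
  simpa [jPlus] using congrFun h i.castSucc

lemma jMinus_injective (m : ℕ) : Function.Injective (jMinus k m) := (linSES_jMinus m).1

lemma piPlus_single_castSucc (m : ℕ) (j : Fin m) :
    piPlus k m (Pi.single j.castSucc 1) = Pi.single j 1 := by
  ext i
  simp [piPlus, Pi.single_apply]

lemma piPlus_single_last (m : ℕ) : piPlus k m (Pi.single (Fin.last m) 1) = 0 := by
  ext i
  simp [piPlus, Fin.castSucc_ne_last]

lemma piMinus_single_succ (m : ℕ) (j : Fin m) :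
    piMinus k m (Pi.single j.succ 1) = Pi.single j 1 := by
  ext i
  simp [piMinus, Pi.single_apply]

lemma piMinus_single_zero (m : ℕ) : piMinus k m (Pi.single 0 1) = 0 := by
  ext i
  simp [piMinus]

lemma jPlus_single (m : ℕ) (j : Fin m) :
    jPlus k m (Pi.single j 1) = Pi.single j.castSucc 1 := by
  ext i
  refine Fin.lastCases ?_ (fun i => ?_) i <;> simp [jPlus, Pi.single_apply, (Fin.castSucc_ne_last _).symm]

lemma jMinus_single (m : ℕ) (j : Fin m) :
    jMinus k m (Pi.single j 1) = Pi.single j.succ 1 := by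
  ext i
  refine Fin.cases ?_ (fun i => ?_) i <;> simp [jMinus, Pi.single_apply, (Fin.succ_ne_zero _).symm]

lemma linearMap_eq_smul_id {m n : ℕ} (hmn : n = m) (A : (Fin m → k) →ₗ[k] (Fin n → k)) (c : k)
    (h : ∀ (i : Fin n) (j : Fin m), A (Pi.single j 1) i = if (i : ℕ) = j then c else 0) :
    ∀ x i, A x i = c * x (Fin.cast hmn i) := by
  subst hmn
  intro x i
  have : A = c • LinearMap.id := by
    refine (Pi.basisFun k (Fin n)).ext fun j => ?_
    ext i
    simp [h, Pi.single_apply, Fin.ext_iff]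
  simp [this]

/-- Deleting the last or the first row of `A` yields the same `C` up to a column shift, which is the
Toeplitz condition. The zeros come from the basis vectors killed by `piMinus` and `piPlus`. -/
lemma pi_toeplitz {m n : ℕ} {A : (Fin (m + 1) → k) →ₗ[k] (Fin (n + 1) → k)}
    {C : (Fin m → k) →ₗ[k] (Fin n → k)} (hp : C ∘ₗ piPlus k m = piPlus k n ∘ₗ A)
    (hm : C ∘ₗ piMinus k m = piMinus k n ∘ₗ A)
    :
    (∀ (i : Fin n) (j : Fin m), A (Pi.single j.succ 1) i.succ = A (Pi.single j.castSucc 1) i.castSucc) ∧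
    (∀ i : Fin n, A (Pi.single 0 1) i.succ = 0) ∧
    (∀ i : Fin n, A (Pi.single (Fin.last m) 1) i.castSucc = 0) := by
  have hp : ∀ x i, A x (Fin.castSucc i) = C (piPlus k m x) i := fun x i =>
    (congrFun (LinearMap.congr_fun hp x) i).symm
  have hm : ∀ x i, A x (Fin.succ i) = C (piMinus k m x) i := fun x i =>
    (congrFun (LinearMap.congr_fun hm x) i).symm
  refine ⟨fun i j => ?_, fun i => ?_, fun i => ?_⟩
  · rw [hp, hm, piPlus_single_castSucc, piMinus_single_succ]
  · rw [hm, piMinus_single_zero, map_zero]; rfl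
  · rw [hp, piPlus_single_last, map_zero]; rfl

lemma pi_eq_zero {m n : ℕ} {A : (Fin (m + 1) → k) →ₗ[k] (Fin (n + 1) → k)}
    {C : (Fin m → k) →ₗ[k] (Fin n → k)} (hp : C ∘ₗ piPlus k m = piPlus k n ∘ₗ A)
    (hm : C ∘ₗ piMinus k m = piMinus k n ∘ₗ A)
    (hmn : n = m + 1) : A = 0 ∧ C = 0 := by
  obtain ⟨h1, h2, h3⟩ := pi_toeplitz hp hm
  have hT := toeplitz_eq_zero (T := fun i j => A (Pi.single j 1) i) h1 h2 h3 hmn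
  have hA : A = 0 := (Pi.basisFun k (Fin (m + 1))).ext fun j => by
    ext i
    simpa using congrFun (congrFun hT i) j
  refine ⟨hA, ?_⟩
  rw [← LinearMap.cancel_right (piPlus_surjective m), hp, hA, LinearMap.comp_zero,
    LinearMap.zero_comp]

/-- The transposed situation: the Toeplitz matrix is now that of `C`, with the roles of rows and
columns exchanged. -/
lemma j_toeplitz {m n : ℕ} {A : (Fin m → k) →ₗ[k] (Fin n → k)}
    {C : (Fin (m + 1) → k) →ₗ[k] (Fin (n + 1) → k)} (hp : C ∘ₗ jPlus k m = jPlus k n ∘ₗ A)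
    (hm : C ∘ₗ jMinus k m = jMinus k n ∘ₗ A)
    :
    (∀ (j : Fin m) (i : Fin n), C (Pi.single j.succ 1) i.succ = C (Pi.single j.castSucc 1) i.castSucc) ∧
    (∀ j : Fin m, C (Pi.single j.succ 1) 0 = 0) ∧
    (∀ j : Fin m, C (Pi.single j.castSucc 1) (Fin.last n) = 0) := by
  have hp : ∀ j : Fin m, C (Pi.single j.castSucc 1) = jPlus k n (A (Pi.single j 1)) := fun j => by
    rw [← jPlus_single]
    exact LinearMap.congr_fun hp _
  have hm : ∀ j : Fin m, C (Pi.single j.succ 1) = jMinus k n (A (Pi.single j 1)) := fun j => by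
    rw [← jMinus_single]
    exact LinearMap.congr_fun hm _
  refine ⟨fun j i => ?_, fun i => ?_, fun i => ?_⟩ <;> simp [hp, hm, jPlus, jMinus]

lemma j_eq_zero {m n : ℕ} {A : (Fin m → k) →ₗ[k] (Fin n → k)}
    {C : (Fin (m + 1) → k) →ₗ[k] (Fin (n + 1) → k)} (hp : C ∘ₗ jPlus k m = jPlus k n ∘ₗ A)
    (hm : C ∘ₗ jMinus k m = jMinus k n ∘ₗ A)
    (hmn : m = n + 1) : A = 0 ∧ C = 0 := by
  obtain ⟨h1, h2, h3⟩ := j_toeplitz hp hm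
  have hT := toeplitz_eq_zero (T := fun j i => C (Pi.single j 1) i) h1 h2 h3 hmn
  have hC : C = 0 := (Pi.basisFun k (Fin (m + 1))).ext fun j => by
    ext i
    simpa using congrFun (congrFun hT j) i
  refine ⟨?_, hC⟩
  rw [← LinearMap.cancel_left (jPlus_injective n), ← hp, hC, LinearMap.comp_zero,
    LinearMap.zero_comp]

lemma pi_eq_smul {m : ℕ} {A : (Fin (m + 1) → k) →ₗ[k] (Fin (m + 1) → k)}
    {C : (Fin m → k) →ₗ[k] (Fin m → k)} (hp : C ∘ₗ piPlus k m = piPlus k m ∘ₗ A)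
    (hm : C ∘ₗ piMinus k m = piMinus k m ∘ₗ A) :
    ∃ c : k, A = c • LinearMap.id ∧ C = c • LinearMap.id := by
  obtain ⟨h1, h2, h3⟩ := pi_toeplitz hp hm
  obtain ⟨c, hc⟩ := toeplitz_eq_ite (T := fun i j => A (Pi.single j 1) i) h1 h2 h3 rfl
  have hA : A = c • LinearMap.id := LinearMap.ext fun x => funext fun i =>
    linearMap_eq_smul_id rfl A c hc x i
  refine ⟨c, hA, ?_⟩
  rw [← LinearMap.cancel_right (piPlus_surjective m), hp, hA, LinearMap.comp_smul,
    LinearMap.smul_comp, LinearMap.comp_id, LinearMap.id_comp]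

lemma j_eq_smul {m : ℕ} {A : (Fin m → k) →ₗ[k] (Fin m → k)}
    {C : (Fin (m + 1) → k) →ₗ[k] (Fin (m + 1) → k)} (hp : C ∘ₗ jPlus k m = jPlus k m ∘ₗ A)
    (hm : C ∘ₗ jMinus k m = jMinus k m ∘ₗ A) :
    ∃ c : k, A = c • LinearMap.id ∧ C = c • LinearMap.id := by
  obtain ⟨h1, h2, h3⟩ := j_toeplitz hp hm
  obtain ⟨c, hc⟩ := toeplitz_eq_ite (T := fun j i => C (Pi.single j 1) i) h1 h2 h3 rfl
  have hC : C = c • LinearMap.id := LinearMap.ext fun x => funext fun i =>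
    linearMap_eq_smul_id rfl C c (fun i j => (hc j i).trans (by simp only [eq_comm])) x i
  refine ⟨c, ?_, hC⟩
  rw [← LinearMap.cancel_left (jPlus_injective m), ← hp, hC, LinearMap.comp_smul,
    LinearMap.smul_comp, LinearMap.comp_id, LinearMap.id_comp]

end Homs

/-! ### The listed objects are exceptional, and their `Hom`s are controlled by the Euler form. -/

section Exceptional
open Limits Abelian
variable {k : Type u} [Field k]
attribute [local instance] HasExt.standard

lemma isExceptional_iff (X : Rep k Q1) :
    IsExceptional k X ↔ Function.Bijective (fun c : k => c • 𝟙 X) ∧ CobSurj X X := by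
  refine and_congr_right fun _ => ⟨fun h => (subsingleton_ext_one_iff X X).1 (h 1 one_ne_zero),
    fun h n hn => ?_⟩
  by_cases h1 : n = 1
  · subst h1
    exact (subsingleton_ext_one_iff X X).2 h
  · exact subsingleton_ext_of_two_le X X (by omega)

lemma homVanish_iff (X Y : Rep k Q1) :
    HomVanish X Y ↔ Subsingleton (X ⟶ Y) ∧ CobSurj X Y := by
  refine ⟨fun h => ⟨(subsingleton_ext_zero_iff X Y).1 (h 0), (subsingleton_ext_one_iff X Y).1 (h 1)⟩,
    fun h n => ?_⟩
  match n with
  | 0 => exact (subsingleton_ext_zero_iff X Y).2 h.1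
  | 1 => exact (subsingleton_ext_one_iff X Y).2 h.2
  | n + 2 => exact subsingleton_ext_of_two_le X Y (by omega)

lemma HomVanish.eul_eq_zero {X Y : Rep k Q1} (h : HomVanish X Y) : eul (dimv X) (dimv Y) = 0 := by
  rw [homVanish_iff] at h
  have := h.1
  rw [← (finrank_eq_eul_iff X Y).2 h.2, Module.finrank_zero_of_subsingleton, Nat.cast_zero]

lemma homVanish_of_eul_eq_zero {X Y : Rep k Q1} (h : ∀ φ : X ⟶ Y, φ = 0)
    (h0 : eul (dimv X) (dimv Y) = 0) : HomVanish X Y := by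
  have := subsingleton_of_forall_eq 0 h
  rw [homVanish_iff, ← finrank_eq_eul_iff, h0, Module.finrank_zero_of_subsingleton]
  exact ⟨this, Nat.cast_zero⟩

lemma IsExceptional.finrank_end {X : Rep k Q1} (h : IsExceptional k X) :
    Module.finrank k (X ⟶ X) = 1 := by
  rw [← (LinearEquiv.ofBijective (LinearMap.toSpanSingleton k _ (𝟙 X)) h.1).finrank_eq,
    Module.finrank_self]

lemma IsExceptional.eul_self {X : Rep k Q1} (h : IsExceptional k X) :
    eul (dimv X) (dimv X) = 1 := by
  rw [← (finrank_eq_eul_iff X X).2 ((isExceptional_iff X).1 h).2, h.finrank_end, Nat.cast_one]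

/-- Euler norm 1 first gives a nonzero endomorphism, so `End` is exactly one-dimensional; then it
leaves no room for `Ext¹`. -/
lemma isExceptional_of_eul {X : Rep k Q1} (h : ∀ φ : X ⟶ X, ∃ c : k, φ = c • 𝟙 X)
    (h1 : eul (dimv X) (dimv X) = 1) : IsExceptional k X := by
  obtain ⟨φ, hφ⟩ := exists_hom_ne_zero (X := X) (Y := X) (by omega)
  have hid : 𝟙 X ≠ 0 := fun h0 => by
    rw [← Category.comp_id φ, h0, Limits.comp_zero] at hφ
    exact hφ rfl
  have hb : Function.Bijective (fun c : k => c • 𝟙 X) :=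
    ⟨smul_left_injective k hid, fun φ => (h φ).imp fun _ hc => hc.symm⟩
  rw [isExceptional_iff]
  refine ⟨hb, ?_⟩
  rw [← finrank_eq_eul_iff, h1,
    ← (LinearEquiv.ofBijective (LinearMap.toSpanSingleton k _ (𝟙 X)) hb).finrank_eq,
    Module.finrank_self, Nat.cast_one]

/-- Labels for the exceptional representations. -/
inductive Obj : Type
  | e₁ (m : ℕ) | e₂ (m : ℕ) | e₃ (m : ℕ) | e₄ (m : ℕ) | s | s'

variable (k) in
/-- The exceptional representation with a given label. -/
def Obj.rep : Obj → Rep k Q1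
  | e₁ m => E₁ k m
  | e₂ m => E₂ k m
  | e₃ m => E₃ k m
  | e₄ m => E₄ k m
  | s => M k
  | s' => M' k

/-- The vector `(a, b, c)`. -/
def dvec (a b c : ℤ) : Q1 → ℤ
  | Q1.b => a
  | Q1.mid => b
  | Q1.e => c

lemma eul_dvec (a b c a' b' c' : ℤ) : eul (dvec a b c) (dvec a' b' c') =
    a * a' + b * b' + c * c' - a * c' - a * b' - b * c' := rfl

/-- The dimension vector of the exceptional representation with a given label. -/
def Obj.dim : Obj → Q1 → ℤ
  | e₁ m => dvec (m + 1) m m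
  | e₂ m => dvec m (m + 1) (m + 1)
  | e₃ m => dvec m m (m + 1)
  | e₄ m => dvec (m + 1) (m + 1) m
  | s => dvec 0 1 0
  | s' => dvec 1 0 1

lemma dimv_mkRep_eq {nb nm ne : ℕ} (f : (Fin nb → k) →ₗ[k] (Fin ne → k))
    (g : (Fin nb → k) →ₗ[k] (Fin nm → k)) (h : (Fin nm → k) →ₗ[k] (Fin ne → k)) :
    dimv (mkRep k f g h) = dvec nb nm ne :=
  funext (forall_Q1.2 (dimv_mkRep f g h))

lemma dimv_rep (o : Obj) : dimv (o.rep k) = o.dim := by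
  cases o <;> refine (dimv_mkRep_eq _ _ _).trans ?_ <;> simp [Obj.dim]

lemma mkRep_end {nb nm ne : ℕ} {f : (Fin nb → k) →ₗ[k] (Fin ne → k)}
    {g : (Fin nb → k) →ₗ[k] (Fin nm → k)} {h : (Fin nm → k) →ₗ[k] (Fin ne → k)}
    (H : ∀ (ub : (Fin nb → k) →ₗ[k] (Fin nb → k)) (um : (Fin nm → k) →ₗ[k] (Fin nm → k))
      (ue : (Fin ne → k) →ₗ[k] (Fin ne → k)), ue ∘ₗ f = f ∘ₗ ub → um ∘ₗ g = g ∘ₗ ub →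
      ue ∘ₗ h = h ∘ₗ um → ∃ c : k, ub = c • LinearMap.id ∧ um = c • LinearMap.id ∧
        ue = c • LinearMap.id) (φ : mkRep k f g h ⟶ mkRep k f g h) :
    ∃ c : k, φ = c • 𝟙 _ := by
  obtain ⟨ub, um, ue, h1, h2, h3, rfl⟩ := mkRepHom_cases φ
  obtain ⟨c, hb, hm, he⟩ := H ub um ue h1 h2 h3
  exact ⟨c, hom_ext₃ hb hm he⟩

lemma mkRepHom_eq_zero {nb nm ne nb' nm' ne' : ℕ} {f : (Fin nb → k) →ₗ[k] (Fin ne → k)}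
    {g : (Fin nb → k) →ₗ[k] (Fin nm → k)} {h : (Fin nm → k) →ₗ[k] (Fin ne → k)}
    {f' : (Fin nb' → k) →ₗ[k] (Fin ne' → k)} {g' : (Fin nb' → k) →ₗ[k] (Fin nm' → k)}
    {h' : (Fin nm' → k) →ₗ[k] (Fin ne' → k)}
    (H : ∀ (ub : (Fin nb → k) →ₗ[k] (Fin nb' → k)) (um : (Fin nm → k) →ₗ[k] (Fin nm' → k))
      (ue : (Fin ne → k) →ₗ[k] (Fin ne' → k)), ue ∘ₗ f = f' ∘ₗ ub → um ∘ₗ g = g' ∘ₗ ub →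
      ue ∘ₗ h = h' ∘ₗ um → ub = 0 ∧ um = 0 ∧ ue = 0)
    (φ : mkRep k f g h ⟶ mkRep k f' g' h') : φ = 0 := by
  obtain ⟨ub, um, ue, h1, h2, h3, rfl⟩ := mkRepHom_cases φ
  obtain ⟨hb, hm, he⟩ := H ub um ue h1 h2 h3
  exact hom_ext₃ hb hm he

lemma end_fin_one (u : (Fin 1 → k) →ₗ[k] (Fin 1 → k)) : ∃ c : k, u = c • LinearMap.id := by
  refine ⟨u 1 0, LinearMap.ext fun x => ?_⟩
  have hx : x = x 0 • 1 := by
    ext i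
    rw [Subsingleton.elim i 0]
    simp
  ext i
  rw [Subsingleton.elim i 0]
  nth_rewrite 1 [hx]
  simp [mul_comm]

lemma end_rep (o : Obj) : ∀ φ : o.rep k ⟶ o.rep k, ∃ c : k, φ = c • 𝟙 _ := by
  cases o with
  | e₁ m =>
    refine mkRep_end fun ub um ue h1 h2 h3 => ?_
    obtain rfl : ue = um := h3
    obtain ⟨c, hb, he⟩ := pi_eq_smul h1 h2
    exact ⟨c, hb, he, he⟩
  | e₂ m =>
    refine mkRep_end fun ub um ue h1 h2 h3 => ?_
    obtain rfl : ue = um := h3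
    obtain ⟨c, hb, he⟩ := j_eq_smul h1 h2
    exact ⟨c, hb, he, he⟩
  | e₃ m =>
    refine mkRep_end fun ub um ue h1 h2 h3 => ?_
    obtain rfl : um = ub := h2
    obtain ⟨c, hb, he⟩ := j_eq_smul h1 h3
    exact ⟨c, hb, hb, he⟩
  | e₄ m =>
    refine mkRep_end fun ub um ue h1 h2 h3 => ?_
    obtain rfl : um = ub := h2
    obtain ⟨c, hb, he⟩ := pi_eq_smul h1 h3
    exact ⟨c, hb, hb, he⟩
  | s =>
    refine mkRep_end fun ub um ue h1 h2 h3 => ?_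
    obtain ⟨c, hc⟩ := end_fin_one um
    exact ⟨c, linearMap_ext_of_zero _ _, hc, linearMap_ext_of_zero _ _⟩
  | s' =>
    refine mkRep_end fun ub um ue h1 h2 h3 => ?_
    obtain rfl : ue = ub := h1
    obtain ⟨c, hc⟩ := end_fin_one ue
    exact ⟨c, hc, linearMap_ext_of_zero _ _, hc⟩

lemma eul_dim_self (o : Obj) : eul o.dim o.dim = 1 := by
  cases o <;> simp only [Obj.dim, eul_dvec] <;> ring

lemma isExceptional_rep (o : Obj) : IsExceptional k (o.rep k) :=
  isExceptional_of_eul (end_rep o) (by rw [dimv_rep, eul_dim_self])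

lemma linearMap_eq_zero_of_comp_left {U V W : Type*} [AddCommGroup U] [AddCommGroup V]
    [AddCommGroup W] [Module k U] [Module k V] [Module k W] {f : V →ₗ[k] W} {u : U →ₗ[k] V}
    (hf : Function.Injective f) (h : f ∘ₗ u = 0) : u = 0 :=
  LinearMap.ext fun x => hf ((LinearMap.congr_fun h x).trans (map_zero f).symm)

lemma linearMap_eq_zero_of_comp_right {U V W : Type*} [AddCommGroup U] [AddCommGroup V]
    [AddCommGroup W] [Module k U] [Module k V] [Module k W] {f : V →ₗ[k] W} {u : U →ₗ[k] V}
    (hu : Function.Surjective u) (h : f ∘ₗ u = 0) : f = 0 :=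
  LinearMap.ext fun x => by
    obtain ⟨y, rfl⟩ := hu x
    exact LinearMap.congr_fun h y

/-- The vanishing Euler form fixes the relation between the two indices; in the cases with two
indexed families it is what gives the Toeplitz matrices the right shape, or makes both indices 0. -/
lemma hom_rep_eq_zero (o o' : Obj) (h : eul o.dim o'.dim = 0) :
    ∀ φ : o.rep k ⟶ o'.rep k, φ = 0 := by
  rcases o with m | m | m | m | _ | _ <;> rcases o' with n | n | n | n | _ | _ <;>
    simp only [Obj.dim, eul_dvec] at h <;> ring_nf at h <;> try omega
  all_goals refine mkRepHom_eq_zero fun ub um ue h1 h2 h3 => ?_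
  · obtain rfl : ue = um := h3
    have := pi_eq_zero h1 h2 (by omega)
    exact ⟨this.1, this.2, this.2⟩
  · obtain rfl : n = m := by omega
    obtain rfl : um ∘ₗ piMinus k n = ub := h2
    obtain rfl : ue = piMinus k n ∘ₗ um := h3
    -- The pair `ub`, `ue` commutes with both shifts, hence is a scalar `c`. As `ub` factors through
    -- `piMinus` it kills the first basis vector, so `c = 0`.
    obtain ⟨c, hb, he⟩ := pi_eq_smul h1 rfl
    have hc := congrFun (LinearMap.congr_fun hb (Pi.single 0 1)) 0
    rw [LinearMap.comp_apply, piMinus_single_zero, map_zero] at hc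
    obtain rfl : c = 0 := by simpa using hc.symm
    rw [zero_smul] at hb he
    exact ⟨hb, linearMap_eq_zero_of_comp_right (piMinus_surjective n) hb, he⟩
  · obtain rfl : ue = 0 := h3
    exact ⟨h1.symm, linearMap_ext_of_subsingleton _ _, rfl⟩
  · obtain rfl : m = 0 := by omega
    obtain rfl : n = 0 := by omega
    exact ⟨linearMap_ext_of_zero _ _, linearMap_ext_of_subsingleton _ _, linearMap_ext_of_subsingleton _ _⟩
  · obtain rfl : ue = um := h3
    have := j_eq_zero h1 h2 (by omega)
    exact ⟨this.1, this.2, this.2⟩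
  · obtain rfl : n = m := by omega
    obtain rfl : um ∘ₗ jMinus k n = ub := h2
    obtain rfl : ue = jMinus k n ∘ₗ um := h3
    -- Dually: `ue` factors through `jMinus`, so its first coordinate vanishes and the scalar is 0.
    obtain ⟨c, hb, he⟩ := j_eq_smul h1 rfl
    have hc := congrFun (LinearMap.congr_fun he (Pi.single 0 1)) 0
    obtain rfl : c = 0 := by simpa [jMinus] using hc.symm
    rw [zero_smul] at hb he
    exact ⟨hb, linearMap_eq_zero_of_comp_left (jMinus_injective n) he, he⟩
  · obtain rfl : ue = 0 := h3
    exact ⟨h1.symm, linearMap_ext_of_subsingleton _ _, rfl⟩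
  · obtain rfl : m = 0 := by omega
    obtain rfl : n = 0 := by omega
    exact ⟨linearMap_ext_of_zero _ _, linearMap_ext_of_zero _ _, linearMap_ext_of_subsingleton _ _⟩
  · have := j_eq_zero h1 (h3.trans h2) (by omega)
    exact ⟨this.1, h2.trans (by rw [this.1, LinearMap.comp_zero]), this.2⟩
  · obtain rfl : um = ub := h2
    have := j_eq_zero h1 h3 (by omega)
    exact ⟨this.1, this.1, this.2⟩
  · obtain rfl : m = 0 := by omega
    obtain rfl : n = 0 := by omega
    exact ⟨linearMap_ext_of_zero _ _, linearMap_ext_of_zero _ _, linearMap_ext_of_subsingleton _ _⟩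
  · exact ⟨linearMap_ext_of_subsingleton _ _, h2, linearMap_ext_of_subsingleton _ _⟩
  · have := pi_eq_zero h1 (h3.trans h2) (by omega)
    exact ⟨this.1, h2.trans (by rw [this.1, LinearMap.comp_zero]), this.2⟩
  · obtain rfl : um = ub := h2
    have := pi_eq_zero h1 h3 (by omega)
    exact ⟨this.1, this.1, this.2⟩
  · exact ⟨linearMap_ext_of_subsingleton _ _, h2, linearMap_ext_of_subsingleton _ _⟩
  · exact ⟨linearMap_ext_of_zero _ _, h3.symm.trans ue.comp_zero, linearMap_ext_of_zero _ _⟩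
  · exact ⟨linearMap_ext_of_zero _ _, h3.symm.trans ue.comp_zero, linearMap_ext_of_zero _ _⟩
  · obtain rfl : 0 = ub := um.comp_zero.symm.trans h2
    exact ⟨rfl, linearMap_ext_of_zero _ _, h1.trans (LinearMap.comp_zero _)⟩
  · obtain rfl : 0 = ub := um.comp_zero.symm.trans h2
    exact ⟨rfl, linearMap_ext_of_zero _ _, h1.trans (LinearMap.comp_zero _)⟩

end Exceptional

/-! ### Classification of the exceptional representations. -/

section Classification
open Limits
variable {k : Type u} [Field k]
attribute [local instance] HasExt.standard

/-- Right exactness of `Ext¹(X, -)`, seen on cochains: lift along vertexwise sections, solve, and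
push the solution forward. -/
lemma CobSurj.of_epi {X Y Z : Rep k Q1} (h : CobSurj X Y) (φ : Y ⟶ Z) [Epi φ] : CobSurj X Z := by
  intro c
  choose s hs using fun v => exists_section φ v
  obtain ⟨t, ht⟩ := h fun i j a => s j ∘ₗ c i j a
  refine ⟨fun v => comp φ v ∘ₗ t v, fun i j a => ?_⟩
  refine LinearMap.ext fun x => ?_
  have h1 := congrArg (comp φ j) (LinearMap.congr_fun (ht i j a) x)
  have h2 := LinearMap.congr_fun (hs j) (c i j a x)
  refine h2.symm.trans (h1.trans ?_)
  exact (map_sub _ _ _).trans (congrArg₂ (· - ·) (comp_act_apply φ a _) rfl)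

/-- A nonzero `f : X ⟶ Y` exists by the Euler form. Since `Ext¹(X, image f) = 0`, the Euler form of
`X` with the image is positive. It is the same for `Y`, which gives a nonzero map from `Y` to the
image. Composed with the inclusion it is a nonzero scalar, so the inclusion is split epi and `f` is
onto. -/
lemma nonempty_iso_of_dimv_eq {X Y : Rep k Q1} (hX : IsExceptional k X) (hY : IsExceptional k Y)
    (h : dimv X = dimv Y) : Nonempty (X ≅ Y) := by
  obtain ⟨f, hf⟩ := exists_hom_ne_zero (X := X) (Y := Y) (by rw [← h, hX.eul_self]; exact one_pos)
  have hXI : CobSurj X (image f) :=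
    ((isExceptional_iff X).1 hX).2.of_epi (factorThruImage f)
  have hne : factorThruImage f ≠ 0 := fun h0 => by
    rw [← image.fac f, h0, zero_comp] at hf
    exact hf rfl
  have hpos : 0 < Module.finrank k (X ⟶ image f) :=
    have : Nontrivial (X ⟶ image f) := ⟨⟨_, _, hne⟩⟩
    Module.finrank_pos
  obtain ⟨g, hg⟩ := exists_hom_ne_zero (X := Y) (Y := image f) (by
    rw [← h, ← (finrank_eq_eul_iff X _).2 hXI]
    exact_mod_cast hpos)
  obtain ⟨c, hc⟩ := hY.1.2 (g ≫ image.ι f)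
  have hc0 : c ≠ 0 := by
    rintro rfl
    have hz : g ≫ image.ι f = 0 := hc.symm.trans (zero_smul k _)
    exact hg (zero_of_comp_mono _ hz)
  have : IsSplitEpi (image.ι f) := IsSplitEpi.mk' ⟨c⁻¹ • g, by
    rw [Linear.smul_comp, ← hc]
    exact inv_smul_smul₀ hc0 _⟩
  have hfe : Epi f := by
    rw [← image.fac f]
    exact epi_comp _ _
  have hs := (epi_iff f).1 hfe
  have : IsIso f := (isIso_iff f).2 fun v => ⟨(LinearMap.injective_iff_surjective_of_finrank_eq_finrank
    (Nat.cast_injective (congrFun h v))).2 (hs v), hs v⟩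
  exact ⟨asIso f⟩

lemma comp_ne_zero_of_line {V W : Type*} [AddCommGroup V] [Module k V] [AddCommGroup W] [Module k W]
    {u : (Fin 1 → k) →ₗ[k] V} {w : W →ₗ[k] (Fin 1 → k)} (h : u ∘ₗ w = 0) : u = 0 ∨ w = 0 := by
  by_contra! hne
  obtain ⟨x, hx⟩ := DFunLike.ne_iff.1 hne.2
  have hx0 : w x 0 ≠ 0 := fun h0 => hx (by
    ext i
    rw [Subsingleton.elim i 0, h0]
    rfl)
  refine hne.1 (LinearMap.ext fun c => ?_)
  have hc : c = (c 0 / w x 0) • w x := by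
    ext i
    rw [Subsingleton.elim i 0]
    simp [hx0]
  rw [hc, map_smul]
  have : u (w x) = 0 := LinearMap.congr_fun h x
  simp [this]

lemma nontrivial_of_dimv_pos {X : Rep k Q1} {v : Q1} (h : 0 < dimv X v) : Nontrivial (X.obj v) :=
  Module.nontrivial_of_finrank_pos (R := k) (Nat.cast_pos.1 h)

/-- An endomorphism of an exceptional object that vanishes at a vertex of its support is zero. -/
lemma IsExceptional.eq_zero_of_comp_eq_zero {X : Rep k Q1} (hX : IsExceptional k X) (φ : X ⟶ X)
    {v : Q1} (hv : 0 < dimv X v) (h : comp φ v = 0) : φ = 0 := by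
  obtain ⟨c, rfl⟩ := hX.1.2 φ
  have := nontrivial_of_dimv_pos hv
  obtain ⟨x, hx⟩ := exists_ne (0 : X.obj v)
  have h1 : c • x = 0 := LinearMap.congr_fun h x
  obtain rfl : c = 0 := (smul_eq_zero.1 h1).resolve_right hx
  exact zero_smul k _

/-- Both Euler forms with `M` equal 1, so there are nonzero maps `M ⟶ X` and `X ⟶ M`. For m > 0 the
composite on `X` vanishes at `b`, hence is zero; but nonzero maps composed through a line have
nonzero composite. -/
lemma not_isExceptional_of_dimv_mid {X : Rep k Q1} {m : ℕ} (hX : IsExceptional k X)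
    (h : dimv X = dvec m (m + 1) m) : m = 0 := by
  by_contra hm
  have hd := dimv_rep (k := k) Obj.s
  obtain ⟨φ, hφ⟩ := exists_hom_ne_zero (X := M k) (Y := X) (by
    change 0 < eul (dimv (Obj.s.rep k)) _
    rw [hd, h, Obj.dim, eul_dvec]
    ring_nf
    omega)
  obtain ⟨ψ, hψ⟩ := exists_hom_ne_zero (X := X) (Y := M k) (by
    change 0 < eul _ (dimv (Obj.s.rep k))
    rw [hd, h, Obj.dim, eul_dvec]
    ring_nf
    omega)
  have h0 := hX.eq_zero_of_comp_eq_zero (ψ ≫ φ) (v := Q1.b)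
    (by rw [h]; change (0 : ℤ) < m; omega) (by
      have : comp φ Q1.b = 0 := linearMap_ext_of_zero _ _
      rw [comp_comp, this, LinearMap.zero_comp])
  have h1 : comp φ Q1.mid ∘ₗ comp ψ Q1.mid = 0 := by
    rw [← comp_comp, h0]
    rfl
  rcases comp_ne_zero_of_line h1 with h2 | h2
  · exact hφ (hom_ext₃ (linearMap_ext_of_zero _ _) h2 (linearMap_ext_of_zero _ _))
  · exact hψ (hom_ext₃ (linearMap_ext_of_subsingleton (W := Fin 0 → k) _ _) h2
      (linearMap_ext_of_subsingleton (W := Fin 0 → k) _ _))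

/-- Again the maps `φ : M' ⟶ X` and `ψ : X ⟶ M'` have zero composite on `X`. As `φ` is determined at
`b` and `ψ` at `e`, this forces the map of `X` along `b ⟶ e` to kill the image of `φ` and to land in
the kernel of `ψ`. Then a rank-one cochain along this arrow is not a coboundary, against `Ext¹(X, X)
= 0`. -/
lemma not_isExceptional_of_dimv_b_e {X : Rep k Q1} {m : ℕ} (hX : IsExceptional k X)
    (h : dimv X = dvec (m + 1) m (m + 1)) : m = 0 := by
  by_contra hm
  have hd := dimv_rep (k := k) Obj.s'
  obtain ⟨φ, hφ⟩ := exists_hom_ne_zero (X := M' k) (Y := X) (by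
    change 0 < eul (dimv (Obj.s'.rep k)) _
    rw [hd, h, Obj.dim, eul_dvec]
    ring_nf
    omega)
  obtain ⟨ψ, hψ⟩ := exists_hom_ne_zero (X := X) (Y := M' k) (by
    change 0 < eul _ (dimv (Obj.s'.rep k))
    rw [hd, h, Obj.dim, eul_dvec]
    ring_nf
    omega)
  have h0 := hX.eq_zero_of_comp_eq_zero (ψ ≫ φ) (v := Q1.mid)
    (by rw [h]; change (0 : ℤ) < m; omega) (by
      have : comp φ Q1.mid = 0 := linearMap_ext_of_zero _ _
      rw [comp_comp, this, LinearMap.zero_comp])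
  have hb : comp φ Q1.b ∘ₗ comp ψ Q1.b = 0 := by
    rw [← comp_comp, h0]
    rfl
  have he : comp φ Q1.e ∘ₗ comp ψ Q1.e = 0 := by
    rw [← comp_comp, h0]
    rfl
  have hf : actBE (M' k) = LinearMap.id := actBE_mkRep ..
  have φbe : comp φ Q1.e = actBE X ∘ₗ comp φ Q1.b := by
    have := comp_actBE φ
    rw [hf] at this
    exact this
  have ψbe : comp ψ Q1.e ∘ₗ actBE X = comp ψ Q1.b := by
    have := comp_actBE ψ
    rw [hf] at this
    exact this
  have φb : comp φ Q1.b ≠ 0 := fun hz => hφ (hom_ext₃ hz (linearMap_ext_of_zero _ _)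
    (φbe.trans (by rw [hz, LinearMap.comp_zero]; rfl)))
  have ψe : comp ψ Q1.e ≠ 0 := fun hz => hψ (hom_ext₃
    (ψbe.symm.trans (by rw [hz, LinearMap.zero_comp]; rfl))
    (linearMap_ext_of_subsingleton (W := Fin 0 → k) _ _) hz)
  have ψb : comp ψ Q1.b = 0 := (comp_ne_zero_of_line hb).resolve_left φb
  have φe : comp φ Q1.e = 0 := (comp_ne_zero_of_line he).resolve_right ψe
  obtain ⟨x, hx⟩ := DFunLike.ne_iff.1 φb
  obtain ⟨w, hw⟩ := DFunLike.ne_iff.1 ψe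
  have hfx : actBE X (comp φ Q1.b x) = 0 :=
    (LinearMap.congr_fun φbe x).symm.trans (LinearMap.congr_fun φe x)
  have hψf : ∀ y, comp ψ Q1.e (actBE X y) = 0 := fun y =>
    (LinearMap.congr_fun ψbe y).trans (LinearMap.congr_fun ψb y)
  obtain ⟨ξ, hξ⟩ : ∃ ξ : Module.Dual k (X.obj Q1.b), ξ (comp φ Q1.b x) ≠ 0 := by
    by_contra! hall
    exact hx ((Module.forall_dual_apply_eq_zero_iff k _).1 hall)
  -- Evaluated at `comp φ Q1.b x` and followed by `ψ`, every coboundary gives 0, whereas this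
  -- cochain gives a nonzero multiple of `comp ψ Q1.e w`, itself nonzero.
  obtain ⟨t, ht⟩ := (cobSurj_iff X X).1 ((isExceptional_iff X).1 hX).2 (ξ.smulRight w, 0, 0)
  have h1 := congrArg (comp ψ Q1.e) (LinearMap.congr_fun (congrArg Prod.fst ht) (comp φ Q1.b x))
  have h2 : comp ψ Q1.e (actBE X (t.1 (comp φ Q1.b x)) - t.2.2 (actBE X (comp φ Q1.b x))) =
    comp ψ Q1.e (ξ (comp φ Q1.b x) • w) := h1
  rw [hfx, map_zero, sub_zero, hψf, map_smul] at h2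
  exact (smul_ne_zero hξ hw) h2.symm

lemma exists_dim_eq {a b c : ℤ} (ha : 0 ≤ a) (hb : 0 ≤ b) (hc : 0 ≤ c)
    (h : eul (dvec a b c) (dvec a b c) = 1) :
    (∃ o : Obj, o.dim = dvec a b c) ∨ (∃ m : ℕ, dvec a b c = dvec m (m + 1) m) ∨
      ∃ m : ℕ, dvec a b c = dvec (m + 1) m (m + 1) := by
  rw [eul_dvec] at h
  lift a to ℕ using ha
  lift b to ℕ using hb
  lift c to ℕ using hc
  obtain ⟨p, hp⟩ : ∃ p : ℤ, p = a - b := ⟨_, rfl⟩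
  obtain ⟨q, hq⟩ : ∃ q : ℤ, q = b - c := ⟨_, rfl⟩
  have hpq : p * p + p * q + q * q = 1 := by
    rw [hp, hq, ← h]
    ring
  -- Here 4(p² + pq + q²) = (2q + p)² + 3p², which bounds p, and symmetrically q.
  have hp1 : p ≤ 1 := by nlinarith [sq_nonneg (2 * q + p)]
  have hp2 : -1 ≤ p := by nlinarith [sq_nonneg (2 * q + p)]
  have hq1 : q ≤ 1 := by nlinarith [sq_nonneg (2 * p + q)]
  have hq2 : -1 ≤ q := by nlinarith [sq_nonneg (2 * p + q)]
  interval_cases p <;> interval_cases q <;> norm_num at hpq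
  · obtain rfl : b = a + 1 := by omega
    obtain rfl : c = a + 1 := by omega
    exact Or.inl ⟨.e₂ a, by push_cast; rfl⟩
  · obtain rfl : b = a + 1 := by omega
    obtain rfl : c = a := by omega
    exact Or.inr (Or.inl ⟨c, by push_cast; rfl⟩)
  · obtain rfl : b = a := by omega
    obtain rfl : c = b + 1 := by omega
    exact Or.inl ⟨.e₃ b, by push_cast; rfl⟩
  · obtain rfl : b = c + 1 := by omega
    obtain rfl : a = c + 1 := by omega
    exact Or.inl ⟨.e₄ c, by push_cast; rfl⟩
  · obtain rfl : a = b + 1 := by omega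
    obtain rfl : c = b + 1 := by omega
    exact Or.inr (Or.inr ⟨b, by push_cast; rfl⟩)
  · obtain rfl : a = b + 1 := by omega
    obtain rfl : c = b := by omega
    exact Or.inl ⟨.e₁ c, by push_cast; rfl⟩

lemma dimv_eq_dvec (X : Rep k Q1) : dimv X = dvec (dimv X Q1.b) (dimv X Q1.mid) (dimv X Q1.e) :=
  funext (forall_Q1.2 ⟨rfl, rfl, rfl⟩)

/-- The exceptional representations of `Q₁`. -/
theorem exists_iso_rep {X : Rep k Q1} (hX : IsExceptional k X) :
    ∃ o : Obj, Nonempty (X ≅ o.rep k) := by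
  have h1 := hX.eul_self
  have h2 : ∃ o : Obj, o.dim = dimv X := by
    rw [dimv_eq_dvec X] at h1 ⊢
    rcases exists_dim_eq (Nat.cast_nonneg _) (Nat.cast_nonneg _) (Nat.cast_nonneg _) h1 with
      h | ⟨m, hm⟩ | ⟨m, hm⟩
    · exact h
    · replace hm : dimv X = _ := (dimv_eq_dvec X).trans hm
      obtain rfl := not_isExceptional_of_dimv_mid hX hm
      rw [← dimv_eq_dvec X, hm]
      exact ⟨.s, by simp [Obj.dim]⟩
    · replace hm : dimv X = _ := (dimv_eq_dvec X).trans hm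
      obtain rfl := not_isExceptional_of_dimv_b_e hX hm
      rw [← dimv_eq_dvec X, hm]
      exact ⟨.s', by simp [Obj.dim]⟩
  obtain ⟨o, ho⟩ := h2
  exact ⟨o, nonempty_iso_of_dimv_eq hX (isExceptional_rep o) (by rw [dimv_rep, ho])⟩

lemma dim_injective : Function.Injective Obj.dim := by
  intro o o' h
  have hb := congrFun h Q1.b
  have hm := congrFun h Q1.mid
  have he := congrFun h Q1.e
  rcases o with m | m | m | m | _ | _ <;> rcases o' with n | n | n | n | _ | _ <;>
    simp only [Obj.dim, dvec] at hb hm he <;>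
    first | rfl | (exfalso; omega) | (congr 1; omega)

lemma eq_of_iso_rep {o o' : Obj} (h : Nonempty (o.rep k ≅ o'.rep k)) : o = o' := by
  obtain ⟨i⟩ := h
  apply dim_injective
  rw [← dimv_rep (k := k), ← dimv_rep (k := k), dimv_eq_of_iso i]

lemma IsExceptional.of_iso {X Y : Rep k Q1} (hX : IsExceptional k X) (i : X ≅ Y) :
    IsExceptional k Y := by
  refine isExceptional_of_eul (fun φ => ?_) (by rw [← dimv_eq_of_iso i, hX.eul_self])
  obtain ⟨c, hc⟩ := hX.1.2 (i.hom ≫ φ ≫ i.inv)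
  refine ⟨c, ?_⟩
  rw [← cancel_epi i.hom, ← cancel_mono i.inv, Category.assoc, ← hc]
  simp

/-- The passage from homological algebra to arithmetic: once `Hom` is known to vanish, so does
`Ext¹`, because the Euler form is 0. -/
lemma homVanish_iff_of_iso {X Y : Rep k Q1} {o o' : Obj} (i : X ≅ o.rep k) (j : Y ≅ o'.rep k) :
    HomVanish X Y ↔ eul o.dim o'.dim = 0 := by
  rw [← dimv_rep (k := k) o, ← dimv_rep (k := k) o', ← dimv_eq_of_iso i, ← dimv_eq_of_iso j]
  refine ⟨HomVanish.eul_eq_zero, fun h => homVanish_of_eul_eq_zero (fun φ => ?_) h⟩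
  rw [dimv_eq_of_iso i, dimv_eq_of_iso j, dimv_rep, dimv_rep] at h
  have h1 := hom_rep_eq_zero o o' h (i.inv ≫ φ ≫ j.hom)
  rw [← cancel_epi i.inv, ← cancel_mono j.hom, Category.assoc, h1]
  simp

end Classification

/-! ### Generation of the bounded derived category. -/

section Derived

open Pretriangulated Triangulated DerivedCategory.TStructure

universe w

variable {C : Type u} [Category.{v} C] [Abelian C]

section

variable [HasDerivedCategory.{w} C] (Q : ObjectProperty (DerivedCategory C)) [Q.IsTriangulated]

/-- The two-out-of-three property for the members of a short exact sequence. -/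
lemma prop_single_of_shortExact [Q.IsClosedUnderIsomorphisms] {S : ShortComplex C}
    (hS : S.ShortExact) :
    (Q ((DerivedCategory.singleFunctor C 0).obj S.X₂) →
      Q ((DerivedCategory.singleFunctor C 0).obj S.X₃) →
        Q ((DerivedCategory.singleFunctor C 0).obj S.X₁)) ∧
    (Q ((DerivedCategory.singleFunctor C 0).obj S.X₁) →
      Q ((DerivedCategory.singleFunctor C 0).obj S.X₃) →
        Q ((DerivedCategory.singleFunctor C 0).obj S.X₂)) ∧
    (Q ((DerivedCategory.singleFunctor C 0).obj S.X₁) →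
      Q ((DerivedCategory.singleFunctor C 0).obj S.X₂) →
        Q ((DerivedCategory.singleFunctor C 0).obj S.X₃)) :=
  have hT := hS.singleTriangle_distinguished
  ⟨Q.ext_of_isTriangulatedClosed₁ _ hT, Q.ext_of_isTriangulatedClosed₂ _ hT,
    Q.ext_of_isTriangulatedClosed₃ _ hT⟩

/-- A triangulated subcategory that contains the objects of `C` contains every bounded complex. -/
lemma prop_of_isGE_of_isLE [Q.IsClosedUnderIsomorphisms]
    (hQ : ∀ X : C, Q ((DerivedCategory.singleFunctor C 0).obj X)) (n : ℕ) :
    ∀ (a : ℤ) (Y : DerivedCategory C) (_ : Y.IsGE a) (_ : Y.IsLE (a + n)), Q Y := by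
  have hsingle (a : ℤ) (Y : DerivedCategory C) (_ : Y.IsGE a) (_ : Y.IsLE a) : Q Y := by
    obtain ⟨X, ⟨i⟩⟩ := DerivedCategory.exists_iso_singleFunctor_obj_of_isGE_of_isLE Y a
    have h := Q.le_shift (-a) _ (hQ X)
    exact Q.prop_of_iso
      (((DerivedCategory.singleFunctors C).shiftIso (-a) a 0 (by simp)).app X ≪≫ i.symm) h
  induction n with
  | zero =>
    intro a Y h₁ h₂
    exact hsingle a Y h₁ (by simpa using h₂)
  | succ n ih =>
    intro a Y h₁ h₂
    -- The truncation triangle splits off the top degree.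
    refine Q.ext_of_isTriangulatedClosed₂ _
      ((t (C := C)).triangleLTGE_distinguished (a + (n + 1 : ℕ)) Y) ?_ ?_
    · refine ih a _ ?_ ?_
      · change (t (C := C)).IsGE (((t (C := C)).truncLT _).obj Y) a
        infer_instance
      · exact (t (C := C)).isLE_truncLT_obj Y _ _ (by push_cast; lia)
    · refine hsingle (a + (n + 1 : ℕ)) _ ?_ ?_
      · exact (t (C := C)).isGE_truncGE_obj Y _ _ le_rfl
      · change (t (C := C)).IsLE (((t (C := C)).truncGE _).obj Y) _
        infer_instance

end

attribute [local instance] HasExt.standard HasDerivedCategory.standard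

/-- Subcategories are transported along the fully faithful inclusion of `D^b(C)`; truncation reduces
bounded objects to objects of `C`. -/
lemma generatesDb_iff (E : List C) :
    GeneratesDb E ↔ ∀ Q : ObjectProperty (DerivedCategory C),
      Q.IsTriangulated → Q.IsClosedUnderIsomorphisms →
        (∀ X ∈ E, Q ((DerivedCategory.singleFunctor C 0).obj X)) →
          ∀ X : C, Q ((DerivedCategory.singleFunctor C 0).obj X) := by
  constructor
  · intro h Q _ _ hE X
    exact h (Q.inverseImage (DerivedCategory.Bounded.ι (C := C))) inferInstance inferInstance
      hE (toDb X)
  · intro h P _ _ hE Y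
    have hP (Y : DerivedCategory.Bounded C) :
        P.map (DerivedCategory.Bounded.ι (C := C)) Y.obj ↔ P Y := by
      refine ⟨fun ⟨Z, hZ, ⟨i⟩⟩ => ?_, fun hY => ⟨Y, hY, ⟨Iso.refl _⟩⟩⟩
      exact P.prop_of_iso ((DerivedCategory.Bounded.ι (C := C)).preimageIso i) hZ
    have hX := h (P.map (DerivedCategory.Bounded.ι (C := C))) inferInstance inferInstance
      (fun X hX => (hP (toDb X)).2 (hE X hX))
    rw [← hP]
    obtain ⟨⟨a, ha⟩, ⟨b, hb⟩⟩ := Y.property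
    refine prop_of_isGE_of_isLE _ hX (b - a).toNat a Y.obj ha ?_
    exact (t (C := C)).isLE_of_le _ b _ (by lia)

lemma hom_shift_eq_zero {X A : C} (h : HomVanish X A) (n : ℤ)
    (f : (DerivedCategory.singleFunctor C 0).obj X ⟶
      ((DerivedCategory.singleFunctor C 0).obj A)⟦n⟧) : f = 0 := by
  obtain hn | hn := lt_or_ge n 0
  · have := (t (C := C)).isGE_shift ((DerivedCategory.singleFunctor C 0).obj A) 0 n (-n)
    exact (t (C := C)).zero f 0 (-n)
  · obtain ⟨m, rfl⟩ := Int.eq_ofNat_of_zero_le hn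
    have := h m
    exact (Abelian.Ext.homEquiv (X := X) (Y := A) (n := m)).symm.injective
      (Subsingleton.elim _ _)

/-- A nonzero object that receives no morphism of any degree from the members of a collection
shows that the collection does not generate. -/
lemma not_generatesDb {E : List C} {A : C} (hA : ¬ Limits.IsZero A)
    (h : ∀ X ∈ E, HomVanish X A) : ¬ GeneratesDb E := by
  intro hE
  rw [generatesDb_iff] at hE
  let R : ObjectProperty (DerivedCategory C) := fun Z =>
    ∃ n : ℤ, Nonempty (Z ≅ ((DerivedCategory.singleFunctor C 0).obj A)⟦n⟧)
  have : R.IsStableUnderShift ℤ := ⟨fun a => ⟨by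
    rintro Z ⟨n, ⟨i⟩⟩
    exact ⟨n + a, ⟨(shiftFunctor _ a).mapIso i ≪≫
      ((shiftFunctorAdd (DerivedCategory C) n a).symm.app _)⟩⟩⟩⟩
  -- `R` consists of all shifts of `A`, so its left orthogonal is triangulated. It would have to
  -- contain `A`, making `𝟙 A` zero.
  have hX := hE R.leftOrthogonal inferInstance inferInstance (by
    rintro X hX Z f ⟨n, ⟨i⟩⟩
    rw [← cancel_mono i.hom, Limits.zero_comp]
    exact hom_shift_eq_zero (h X hX) n _) A
  have h0 := hX (𝟙 _) ⟨0, ⟨((shiftFunctorZero (DerivedCategory C) ℤ).symm.app _)⟩⟩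
  apply hA
  rw [Limits.IsZero.iff_id_eq_zero]
  apply (DerivedCategory.singleFunctor C 0).map_injective
  rw [CategoryTheory.Functor.map_id, h0, CategoryTheory.Functor.map_zero]

end Derived

/-! ### Combinatorics of the labels. -/

section Combinatorics

/-- The pairs of objects of the list with vanishing Euler form. -/
def Obj.EulZero : Obj → Obj → Prop
  | .e₁ m, .e₁ n => n = m + 1
  | .e₁ m, .e₄ n => n = m
  | .e₄ m, .e₁ n => n = m + 1
  | .e₄ m, .e₄ n => n = m + 1
  | .e₂ m, .e₂ n => m = n + 1
  | .e₂ m, .e₃ n => m = n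
  | .e₃ m, .e₂ n => m = n + 1
  | .e₃ m, .e₃ n => m = n + 1
  | .e₂ m, .e₁ n => m = 0 ∧ n = 0
  | .e₃ m, .e₁ n => m = 0 ∧ n = 0
  | .e₃ m, .e₄ n => m = 0 ∧ n = 0
  | .s, .e₁ _ => True
  | .s, .e₂ _ => True
  | .s', .e₃ _ => True
  | .s', .e₄ _ => True
  | .e₃ _, .s => True
  | .e₄ _, .s => True
  | .e₁ _, .s' => True
  | .e₂ _, .s' => True
  | _, _ => False

lemma eul_dim_eq_zero_iff (o o' : Obj) : eul o.dim o'.dim = 0 ↔ o.EulZero o' := by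
  cases o <;> cases o' <;> simp only [Obj.dim, eul_dvec, Obj.EulZero, iff_true, iff_false] <;>
    ring_nf <;> omega

/-- The members of the triple with a given label. -/
def code : Label → List Obj
  | .t11 m => [.e₁ (m + 1), .e₁ m, .s]
  | .t12 m => [.e₁ (m + 1), .e₄ m, .e₁ m]
  | .t13 m => [.e₁ (m + 1), .s, .e₄ m]
  | .t21 => [.e₁ 0, .e₂ 0, .s]
  | .t22 => [.e₁ 0, .e₃ 0, .e₂ 0]
  | .t23 => [.e₁ 0, .s, .e₃ 0]
  | .t31 m => [.e₂ m, .e₂ (m + 1), .s]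
  | .t32 m => [.e₂ m, .e₃ (m + 1), .e₂ (m + 1)]
  | .t33 m => [.e₂ m, .s, .e₃ (m + 1)]
  | .t41 m => [.e₃ m, .e₂ m, .e₃ (m + 1)]
  | .t42 m => [.e₃ m, .e₃ (m + 1), .s']
  | .t43 m => [.e₃ m, .s', .e₂ m]
  | .t51 m => [.e₄ (m + 1), .e₄ m, .s']
  | .t52 m => [.e₄ (m + 1), .e₁ (m + 1), .e₄ m]
  | .t53 m => [.e₄ (m + 1), .s', .e₁ (m + 1)]
  | .t61 => [.e₄ 0, .e₁ 0, .e₃ 0]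
  | .t62 => [.e₄ 0, .e₃ 0, .s']
  | .t63 => [.e₄ 0, .s', .e₁ 0]
  | .t71 m => [.s, .e₃ m, .e₃ (m + 1)]
  | .t72 m => [.s, .e₄ (m + 1), .e₄ m]
  | .t73 => [.s, .e₄ 0, .e₃ 0]
  | .t81 m => [.s', .e₁ (m + 1), .e₁ m]
  | .t82 m => [.s', .e₂ m, .e₂ (m + 1)]
  | .t83 => [.s', .e₁ 0, .e₂ 0]

lemma map_rep_code (k : Type u) [Field k] (t : Label) :
    (code t).map (Obj.rep k) = triple k t := by
  cases t <;> rfl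

lemma code_injective : Function.Injective code := by
  intro s t h
  cases s <;> cases t <;> simp_all [code]

lemma exists_code_eq (t : Label) : ∃ o₁ o₂ o₃, code t = [o₁, o₂, o₃] := by
  cases t <;> exact ⟨_, _, _, rfl⟩

lemma eulZero_of_code_eq {t : Label} {o₁ o₂ o₃ : Obj} (h : code t = [o₁, o₂, o₃]) :
    o₂.EulZero o₁ ∧ o₃.EulZero o₁ ∧ o₃.EulZero o₂ := by
  cases t <;> obtain ⟨⟩ := h <;> simp [Obj.EulZero]

lemma exists_label_of_eulZero {o₁ o₂ o₃ : Obj} (h₁₂ : o₂.EulZero o₁) (h₁₃ : o₃.EulZero o₁)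
    (h₂₃ : o₃.EulZero o₂) : ∃ t, code t = [o₁, o₂, o₃] := by
  cases o₁ <;> cases o₂ <;> simp only [Obj.EulZero] at h₁₂ <;>
    cases o₃ <;> simp only [Obj.EulZero] at h₁₃ h₂₃ <;>
    (try obtain ⟨h₁₂, h⟩ := h₁₂) <;> (try obtain ⟨h₁₃, h'⟩ := h₁₃) <;>
    (try obtain ⟨h₂₃, h''⟩ := h₂₃) <;> (try subst h₁₂) <;> (try subst h₁₃) <;>
    (try subst h₂₃) <;> subst_vars <;> (try omega) <;>
    first
      | exact ⟨.t11 _, rfl⟩ | exact ⟨.t12 _, rfl⟩ | exact ⟨.t13 _, rfl⟩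
      | exact ⟨.t21, rfl⟩ | exact ⟨.t22, rfl⟩ | exact ⟨.t23, rfl⟩
      | exact ⟨.t31 _, rfl⟩ | exact ⟨.t32 _, rfl⟩ | exact ⟨.t33 _, rfl⟩
      | exact ⟨.t41 _, rfl⟩ | exact ⟨.t42 _, rfl⟩ | exact ⟨.t43 _, rfl⟩
      | exact ⟨.t51 _, rfl⟩ | exact ⟨.t52 _, rfl⟩ | exact ⟨.t53 _, rfl⟩
      | exact ⟨.t61, rfl⟩ | exact ⟨.t62, rfl⟩ | exact ⟨.t63, rfl⟩
      | exact ⟨.t71 _, rfl⟩ | exact ⟨.t72 _, rfl⟩ | exact ⟨.t73, rfl⟩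
      | exact ⟨.t81 _, rfl⟩ | exact ⟨.t82 _, rfl⟩ | exact ⟨.t83, rfl⟩
      -- The triple (`e₄ m`, `s'`, `e₁ m`) is listed separately for m = 0 and m > 0.
      | (rename_i m; cases m; exacts [⟨.t63, rfl⟩, ⟨.t53 _, rfl⟩])

lemma exists_eulZero (o : Obj) : ∃ o', o.EulZero o' := by
  cases o
  exacts [⟨.s', trivial⟩, ⟨.s', trivial⟩, ⟨.s, trivial⟩, ⟨.s, trivial⟩, ⟨.e₁ 0, trivial⟩,
    ⟨.e₃ 0, trivial⟩]

/-- Every exceptional pair extends on the left to a triple; the new member shows that the pair does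
not generate. -/
lemma exists_eulZero_of_eulZero {o₁ o₂ : Obj} (h : o₂.EulZero o₁) :
    ∃ o, o₁.EulZero o ∧ o₂.EulZero o := by
  cases o₁ with
  | e₁ m => cases o₂ with
    | e₁ n => exact ⟨.s', trivial, trivial⟩
    | e₂ n => exact ⟨.s', trivial, trivial⟩
    | e₃ n => exact ⟨.e₄ 0, h.2.symm, h.1, rfl⟩
    | e₄ n => exact ⟨.e₄ (n + 1), h.symm, rfl⟩
    | s => exact ⟨.e₁ (m + 1), rfl, trivial⟩
    | s' => exact h.elim
  | e₂ m => cases o₂ with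
    | e₂ n => exact ⟨.s', trivial, trivial⟩
    | e₃ n => exact ⟨.e₃ m, rfl, h⟩
    | s => cases m with
      | zero => exact ⟨.e₁ 0, ⟨rfl, rfl⟩, trivial⟩
      | succ m => exact ⟨.e₂ m, rfl, trivial⟩
    | e₁ n => exact h.elim
    | e₄ n => exact h.elim
    | s' => exact h.elim
  | e₃ m => cases o₂ with
    | e₃ n => exact ⟨.s, trivial, trivial⟩
    | e₂ n => cases m with
      | zero => exact ⟨.e₁ 0, ⟨rfl, rfl⟩, h, rfl⟩
      | succ m => exact ⟨.e₂ m, rfl, h⟩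
    | s' => cases m with
      | zero => exact ⟨.e₄ 0, ⟨rfl, rfl⟩, trivial⟩
      | succ m => exact ⟨.e₃ m, rfl, trivial⟩
    | e₁ n => exact h.elim
    | e₄ n => exact h.elim
    | s => exact h.elim
  | e₄ m => cases o₂ with
    | e₁ n => exact ⟨.e₁ (m + 1), rfl, by rw [show m = n from h]; rfl⟩
    | e₃ n => exact ⟨.s, trivial, trivial⟩
    | e₄ n => exact ⟨.s, trivial, trivial⟩
    | s' => exact ⟨.e₄ (m + 1), rfl, trivial⟩
    | e₂ n => exact h.elim
    | s => exact h.elim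
  | s => cases o₂ with
    | e₃ n => cases n with
      | zero => exact ⟨.e₁ 0, trivial, rfl, rfl⟩
      | succ n => exact ⟨.e₂ n, trivial, rfl⟩
    | e₄ n => exact ⟨.e₁ (n + 1), trivial, rfl⟩
    | e₁ n => exact h.elim
    | e₂ n => exact h.elim
    | s => exact h.elim
    | s' => exact h.elim
  | s' => cases o₂ with
    | e₁ n => exact ⟨.e₄ n, trivial, rfl⟩
    | e₂ n => exact ⟨.e₃ n, trivial, rfl⟩
    | e₃ n => exact h.elim
    | e₄ n => exact h.elim
    | s => exact h.elim
    | s' => exact h.elim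

/-- The predicate `G` has the two-out-of-three property on `a`, `b`, `c`. -/
def TwoOfThree (G : Obj → Prop) (a b c : Obj) : Prop :=
  (G b → G c → G a) ∧ (G a → G c → G b) ∧ (G a → G b → G c)

variable {G : Obj → Prop}

/-- Descent on m: `e₁ (m + 1)` leads to `e₄ m` and then `e₁ m`, while `e₃ (m + 1)` leads to `e₂ m`
and then `e₃ m`. At m = 0, `h₀` gives whichever of `e₁ 0` and `e₃ 0` is missing. -/
lemma simples_of_s_of_s' (h₄ : ∀ m, TwoOfThree G .s (.e₄ m) (.e₁ m))
    (h₂ : ∀ m, TwoOfThree G (.e₃ m) (.e₂ m) .s)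
    (h₁ : ∀ m, TwoOfThree G .s' (.e₁ (m + 1)) (.e₄ m))
    (h₃ : ∀ m, TwoOfThree G (.e₂ m) (.e₃ (m + 1)) .s')
    (h₀ : TwoOfThree G (.e₃ 0) .s' (.e₁ 0)) (hs : G .s) (hs' : G .s')
    (h : ∃ m, G (.e₁ m) ∨ G (.e₃ m)) : G (.e₁ 0) ∧ G .s ∧ G (.e₃ 0) := by
  obtain ⟨m, hm⟩ := h
  induction m with
  | zero =>
    obtain hm | hm := hm
    exacts [⟨hm, hs, h₀.1 hs' hm⟩, ⟨h₀.2.2 hm hs', hs, hm⟩]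
  | succ m ih =>
    refine ih (hm.imp (fun hm => ?_) (fun hm => ?_))
    exacts [(h₄ m).2.2 hs ((h₁ m).2.2 hs' hm), (h₂ m).1 ((h₃ m).1 hm hs') hs]

/-- Every triple of the list generates the simple objects. -/
lemma simples_of_code (h₄ : ∀ m, TwoOfThree G .s (.e₄ m) (.e₁ m))
    (h₂ : ∀ m, TwoOfThree G (.e₃ m) (.e₂ m) .s)
    (h₁ : ∀ m, TwoOfThree G .s' (.e₁ (m + 1)) (.e₄ m))
    (h₃ : ∀ m, TwoOfThree G (.e₂ m) (.e₃ (m + 1)) .s')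
    (h₀ : TwoOfThree G (.e₃ 0) .s' (.e₁ 0)) {t : Label} (ht : ∀ o ∈ code t, G o) :
    G (.e₁ 0) ∧ G .s ∧ G (.e₃ 0) := by
  suffices h : G .s ∧ G .s' ∧ ∃ m, G (.e₁ m) ∨ G (.e₃ m) from
    simples_of_s_of_s' h₄ h₂ h₁ h₃ h₀ h.1 h.2.1 h.2.2
  cases t <;> simp only [code, List.forall_mem_cons, List.not_mem_nil, false_imp_iff,
    implies_true, and_true] at ht <;> obtain ⟨ha, hb, hc⟩ := ht <;>
    simp only [TwoOfThree] at h₄ h₂ h₁ h₃ h₀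
  all_goals grind

end Combinatorics

/-! ### Assembly: triples, generation and length. -/

section Main

attribute [local instance] HasExt.standard HasDerivedCategory.standard

variable {k : Type u} [Field k]

lemma isoColl_triple_iff {E : List (Rep k Q1)} {t : Label} :
    IsoColl E (triple k t) ↔
      List.Forall₂ (fun X o => Nonempty (X ≅ Obj.rep k o)) E (code t) := by
  rw [IsoColl, ← map_rep_code, List.forall₂_map_right_iff]

lemma eq_of_isoColl {s t : Label} (h : IsoColl (triple k s) (triple k t)) : s = t := by
  rw [isoColl_triple_iff, ← map_rep_code, List.forall₂_map_left_iff] at h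
  have h' : List.Forall₂ Eq (code s) (code t) := h.imp fun _ _ => eq_of_iso_rep
  rw [List.forall₂_eq_eq_eq] at h'
  exact code_injective h'

lemma homVanish_iff_eulZero {X Y : Rep k Q1} {o o' : Obj} (i : X ≅ o.rep k)
    (j : Y ≅ o'.rep k) : HomVanish X Y ↔ o.EulZero o' :=
  (homVanish_iff_of_iso i j).trans (eul_dim_eq_zero_iff o o')

lemma isExceptionalCollection_triple_iff {X Y Z : Rep k Q1} :
    IsExceptionalCollection k [X, Y, Z] ↔ ∃ t : Label, IsoColl [X, Y, Z] (triple k t) := by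
  constructor
  · rintro ⟨h, h'⟩
    obtain ⟨o₁, ⟨i₁⟩⟩ := exists_iso_rep (h X (by simp))
    obtain ⟨o₂, ⟨i₂⟩⟩ := exists_iso_rep (h Y (by simp))
    obtain ⟨o₃, ⟨i₃⟩⟩ := exists_iso_rep (h Z (by simp))
    obtain ⟨t, ht⟩ := exists_label_of_eulZero
      ((homVanish_iff_eulZero i₂ i₁).1 (by simp_all))
      ((homVanish_iff_eulZero i₃ i₁).1 (by simp_all))
      ((homVanish_iff_eulZero i₃ i₂).1 (by simp_all))
    refine ⟨t, isoColl_triple_iff.2 ?_⟩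
    rw [ht]
    exact .cons ⟨i₁⟩ (.cons ⟨i₂⟩ (.cons ⟨i₃⟩ .nil))
  · rintro ⟨t, ht⟩
    rw [isoColl_triple_iff] at ht
    obtain ⟨o₁, o₂, o₃, h⟩ := exists_code_eq t
    rw [h] at ht
    simp only [List.forall₂_cons, List.forall₂_nil_right_iff, and_true] at ht
    obtain ⟨⟨i₁⟩, ⟨i₂⟩, ⟨i₃⟩⟩ := ht
    obtain ⟨h₁, h₂, h₃⟩ := eulZero_of_code_eq h
    rw [← homVanish_iff_eulZero i₂ i₁] at h₁
    rw [← homVanish_iff_eulZero i₃ i₁] at h₂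
    rw [← homVanish_iff_eulZero i₃ i₂] at h₃
    have e₁ := (isExceptional_rep o₁).of_iso i₁.symm
    have e₂ := (isExceptional_rep o₂).of_iso i₂.symm
    have e₃ := (isExceptional_rep o₃).of_iso i₃.symm
    constructor <;> simp_all

lemma generatesDb_of_isoColl {E : List (Rep k Q1)} {t : Label} (h : IsoColl E (triple k t)) :
    GeneratesDb E := by
  rw [generatesDb_iff]
  intro Q _ _ hE
  let P (X : Rep k Q1) : Prop := Q ((DerivedCategory.singleFunctor _ 0).obj X)
  have hiso {X Y : Rep k Q1} (i : X ≅ Y) (hX : P X) : P Y :=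
    Q.prop_of_iso ((DerivedCategory.singleFunctor _ 0).mapIso i) hX
  have hses {o₁ o₂ o₃ : Obj} (h : HasSES (o₁.rep k) (o₂.rep k) (o₃.rep k)) :
      TwoOfThree (fun o => P (o.rep k)) o₁ o₂ o₃ := by
    obtain ⟨f, g, w, hS⟩ := h
    exact prop_single_of_shortExact Q hS
  have hcode : ∀ o ∈ code t, P (o.rep k) := by
    rw [isoColl_triple_iff] at h
    rw [List.forall₂_iff_get] at h
    intro o ho
    obtain ⟨n, rfl⟩ := List.mem_iff_get.1 ho
    obtain ⟨i⟩ := h.2 n (by have := n.2; have := h.1; omega) n.2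
    exact hiso i (hE _ (List.get_mem _ _))
  obtain ⟨hb, hm, he⟩ := simples_of_code (G := fun o => P (o.rep k))
    (fun m => hses (hasSES_M_E₄_E₁ k m)) (fun m => hses (hasSES_E₃_E₂_M k m))
    (fun m => hses (hasSES_M'_E₁_E₄ k m)) (fun m => hses (hasSES_E₂_E₃_M' k m))
    (hses (hasSES_E₃_M'_E₁ k)) hcode
  exact rep_induction (P := P)
    (fun X hX => Q.prop_of_isZero ((DerivedCategory.singleFunctor _ 0).map_isZero hX))
    (fun S hS => (prop_single_of_shortExact Q hS).2.1) hb hm he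

lemma IsExceptional.not_isZero {X : Rep k Q1} (hX : IsExceptional k X) : ¬ Limits.IsZero X := by
  intro h
  exact one_ne_zero (hX.1.1 (h.eq_of_src ((1 : k) • 𝟙 X) ((0 : k) • 𝟙 X)))

/-- Exceptional collections with fewer than three members do not generate. -/
lemma not_generatesDb_of_length_le {E : List (Rep k Q1)} (hE : IsExceptionalCollection k E)
    (hl : E.length ≤ 2) : ¬ GeneratesDb E := by
  suffices h : ∃ o : Obj, ∀ X ∈ E, HomVanish X (o.rep k) by
    obtain ⟨o, ho⟩ := h
    exact not_generatesDb (isExceptional_rep o).not_isZero ho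
  obtain ⟨h, h'⟩ := hE
  match E, hl with
  | [], _ => exact ⟨.s, by simp⟩
  | [X], _ =>
    obtain ⟨o, ⟨i⟩⟩ := exists_iso_rep (h X (by simp))
    obtain ⟨o', ho⟩ := exists_eulZero o
    refine ⟨o', ?_⟩
    rw [← homVanish_iff_eulZero i (Iso.refl _)] at ho
    simpa using ho
  | [X, Y], _ =>
    obtain ⟨o₁, ⟨i₁⟩⟩ := exists_iso_rep (h X (by simp))
    obtain ⟨o₂, ⟨i₂⟩⟩ := exists_iso_rep (h Y (by simp))
    obtain ⟨o, h₁, h₂⟩ := exists_eulZero_of_eulZero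
      ((homVanish_iff_eulZero i₂ i₁).1 (by simp_all))
    refine ⟨o, ?_⟩
    rw [← homVanish_iff_eulZero i₁ (Iso.refl _)] at h₁
    rw [← homVanish_iff_eulZero i₂ (Iso.refl _)] at h₂
    simp [h₁, h₂]

/-- Exceptional collections with at least three members are listed triples. -/
lemma exists_isoColl_of_le_length {E : List (Rep k Q1)} (hE : IsExceptionalCollection k E)
    (hl : 3 ≤ E.length) : ∃ t : Label, IsoColl E (triple k t) := by
  induction E with
  | nil => simp at hl
  | cons X E ih =>
    obtain ⟨h, h'⟩ := hE
    rw [List.pairwise_cons] at h'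
    obtain hl' | hl' := lt_or_ge E.length 3
    · match E with
      | [Y, Z] => exact isExceptionalCollection_triple_iff.1 ⟨h, List.pairwise_cons.2 h'⟩
      | [] => simp at hl
      | [_] => simp at hl
      | _ :: _ :: _ :: _ => simp only [List.length_cons] at hl'; omega
    · obtain ⟨t, ht⟩ := ih ⟨fun Y hY => h Y (by simp [hY]), h'.2⟩ hl'
      -- The tail is already a listed triple and generates, yet `X` is a nonzero object right
      -- orthogonal to it.
      exact (not_generatesDb (h X (by simp)).not_isZero h'.1 (generatesDb_of_isoColl ht)).elim

lemma isFullExceptionalCollection_iff {E : List (Rep k Q1)} :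
    IsFullExceptionalCollection k E ↔ ∃ t : Label, IsoColl E (triple k t) := by
  constructor
  · rintro ⟨hE, hg⟩
    refine exists_isoColl_of_le_length hE ?_
    by_contra! h
    exact not_generatesDb_of_length_le hE (by omega) hg
  · rintro ⟨t, ht⟩
    refine ⟨?_, generatesDb_of_isoColl ht⟩
    have hlen : E.length = 3 := by
      obtain ⟨_, _, _, h⟩ := exists_code_eq t
      rw [List.Forall₂.length_eq ht, ← map_rep_code, h]
      rfl
    obtain ⟨X, Y, Z, rfl⟩ := List.length_eq_three.1 hlen
    exact isExceptionalCollection_triple_iff.2 ⟨t, ht⟩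

end Main

end ExcColl

end

theorem mainTheorem7 (k : Type u) [Field k] [IsAlgClosed k] :
    -- the full exceptional collections, of any length, are the listed triples
    (∀ E : List (ExcColl.Rep k ExcColl.Q1),
      ExcColl.IsFullExceptionalCollection k E ↔
        ∃ t : ExcColl.Label, ExcColl.IsoColl E (ExcColl.triple k t)) ∧
    -- the exceptional triples are the listed triples
    (∀ X Y Z : ExcColl.Rep k ExcColl.Q1,
      ExcColl.IsExceptionalCollection k [X, Y, Z] ↔
        ∃ t : ExcColl.Label, ExcColl.IsoColl [X, Y, Z] (ExcColl.triple k t)) ∧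
    -- the list has no repetitions up to isomorphism
    (∀ s t : ExcColl.Label,
      ExcColl.IsoColl (ExcColl.triple k s) (ExcColl.triple k t) → s = t) := by
  exact ⟨fun _ => ExcColl.isFullExceptionalCollection_iff,
    fun _ _ _ => ExcColl.isExceptionalCollection_triple_iff,
    fun _ _ => ExcColl.eq_of_isoColl⟩
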